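/- Let $p\in\{3,5,7,11\}$, let $\mathbb K$ be a field of characteristic $p$, and let $n,m$ be integers with $1<n<p+1$ and $1\le m<p$. Let $SL^{n,m}$ be the Lie superalgebra over $\mathbb K$ with even basis $X_1,\dots,X_n,T_1,T_2,T_3$, odd basis $Y_1,\dots,Y_m$, and whose only non-zero brackets of basis vectors, up to super skew-symmetry, are $$[X_1,X_i]=X_{i+1}\ (2\le i\le n-1),\quad [X_1,Y_j]=Y_{j+1}\ (1\le j\le m-1),$$ $$[T_1,X_i]=iX_i\ (1\le i\le n),\quad [T_1,Y_j]=jY_j\ (1\le j\le m),\quad [T_2,X_i]=X_i\ (2\le i\le n),\quad [T_3,Y_j]=Y_j\ (1\le j\le m).$$ Then $SL^{n,m}$ is (cohomologically) rigid, i.e. $H^2(SL^{n,m};SL^{n,m})=0$. Here, for a Lie superalgebra $\mathfrak g=\mathfrak g_{\bar 0}\oplus\mathfrak g_{\bar 1}$, $H^2(\mathfrak g;\mathfrak g)=H^2_{\bar 0}\oplus H^2_{\bar 1}$ is the second cohomology of $\mathfrak g$ with adjoint coefficients, computed (with even and odd cochains both included) from the complex $C^q(\mathfrak g;\mathfrak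 g)=\bigoplus_{q_0+q_1=q}\mathrm{Hom}(\wedge^{q_0}\mathfrak g_{\bar 0}\otimes S^{q_1}\mathfrak g_{\bar 1},\mathfrak g)$ with the usual differential $$\begin{aligned}(dc)(g_1,\dots,g_{q_0},h_1,\dots,h_{q_1})={}&\sum_{s<t}(-1)^{s+t-1}c([g_s,g_t],\dots,\hat g_s,\dots,\hat g_t,\dots,h_1,\dots,h_{q_1})\\&+\sum_{s,t}(-1)^{s-1}c(g_1,\dots,\hat g_s,\dots,g_{q_0},[g_s,h_t],h_1,\dots,\hat h_t,\dots)\\&+\sum_{s<t}c([h_s,h_t],g_1,\dots,g_{q_0},\dots,\hat h_s,\dots,\hat h_t,\dots)\\&+\sum_s(-1)^s[g_s,c(\dots,\hat g_s,\dots,h_1,\dots,h_{q_1})]\\&+(-1)^{q_0-1}\sum_s[h_s,c(g_1,\dots,g_{q_0},\dots,\hat h_s,\dots)]\end{aligned}$$ for $g_i\in\mathfrak g_{\bar 0}$ and $h_i\in\mathfrak g_{\bar 1}$. -/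

import Mathlib

set_option maxSynthPendingDepth 3

/-- A Lie superalgebra over `K` with underlying vector space `V`: a `ℤ/2`-grading of `V`
together with an even bilinear bracket satisfying super skew-symmetry and the graded Jacobi
identity on homogeneous elements. For `α β : ZMod 2`, the sign `(-1)^(α * β)` is written with
the representatives `0, 1` of the parities. -/
structure LieSuperalgebra (K V : Type*) [Field K] [AddCommGroup V] [Module K V] where
  part : ZMod 2 → Submodule K V
  isInternal : DirectSum.IsInternal part
  bracket : V →ₗ[K] V →ₗ[K] V
  bracket_mem : ∀ (α β : ZMod 2), ∀ x ∈ part α, ∀ y ∈ part β, bracket x y ∈ part (α + β)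
  skew : ∀ (α β : ZMod 2), ∀ x ∈ part α, ∀ y ∈ part β,
    bracket x y = -((-1 : K) ^ (α.val * β.val) • bracket y x)
  jacobi : ∀ (α β γ : ZMod 2), ∀ x ∈ part α, ∀ y ∈ part β, ∀ z ∈ part γ,
    (-1 : K) ^ (γ.val * α.val) • bracket x (bracket y z) +
      (-1 : K) ^ (α.val * β.val) • bracket y (bracket z x) +
      (-1 : K) ^ (β.val * γ.val) • bracket z (bracket x y) = 0

namespace LieSuperalgebra

variable {K V : Type*} [Field K] [AddCommGroup V] [Module K V]

/-- The even part `𝔤₀`. -/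
def even (𝔤 : LieSuperalgebra K V) : Submodule K V := 𝔤.part 0

/-- The odd part `𝔤₁`. -/
def odd (𝔤 : LieSuperalgebra K V) : Submodule K V := 𝔤.part 1

/-- The space `C²(𝔤; 𝔤)` of 2-cochains with adjoint coefficients,
`Hom(Λ²𝔤₀, 𝔤) ⊕ Hom(𝔤₀ ⊗ 𝔤₁, 𝔤) ⊕ Hom(S²𝔤₁, 𝔤)`.
A triple of such maps is written as one bilinear map `c` on `𝔤 = 𝔤₀ ⊕ 𝔤₁`, alternating on `𝔤₀`,
symmetric on `𝔤₁`, with the convention `c(h, g) = -c(g, h)` for `g` even and `h` odd.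
Both even and odd cochains (and their sums) are included. -/
def C2 (𝔤 : LieSuperalgebra K V) : Submodule K (V →ₗ[K] V →ₗ[K] V) where
  carrier := {c |
    (∀ g ∈ 𝔤.even, c g g = 0) ∧
    (∀ g ∈ 𝔤.even, ∀ h ∈ 𝔤.odd, c h g = -c g h) ∧
    (∀ h₁ ∈ 𝔤.odd, ∀ h₂ ∈ 𝔤.odd, c h₁ h₂ = c h₂ h₁)}
  zero_mem' := by simp
  add_mem' := by
    rintro a b ⟨a1, a2, a3⟩ ⟨b1, b2, b3⟩
    refine ⟨fun g hg => ?_, fun g hg h hh => ?_, fun h hh h' hh' => ?_⟩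
    · simp [a1 g hg, b1 g hg]
    · simp only [LinearMap.add_apply, a2 g hg h hh, b2 g hg h hh]; abel
    · simp only [LinearMap.add_apply, a3 h hh h' hh', b3 h hh h' hh']
  smul_mem' := by
    rintro r a ⟨a1, a2, a3⟩
    refine ⟨fun g hg => ?_, fun g hg h hh => ?_, fun h hh h' hh' => ?_⟩
    · simp [a1 g hg]
    · simp only [LinearMap.smul_apply, a2 g hg h hh, smul_neg]
    · simp only [LinearMap.smul_apply, a3 h hh h' hh']

/-- `IsCoboundaryOf 𝔤 f c` says `c = d f`, for the differential `d : C¹(𝔤; 𝔤) → C²(𝔤; 𝔤)`,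
where `C¹(𝔤; 𝔤) = Hom(𝔤₀, 𝔤) ⊕ Hom(𝔤₁, 𝔤) = Hom(𝔤, 𝔤)`. The three clauses are the components
of `d f` on `Λ²𝔤₀`, `𝔤₀ ⊗ 𝔤₁` and `S²𝔤₁`. -/
def IsCoboundaryOf (𝔤 : LieSuperalgebra K V) (f : V →ₗ[K] V) (c : V →ₗ[K] V →ₗ[K] V) : Prop :=
  (∀ g₁ ∈ 𝔤.even, ∀ g₂ ∈ 𝔤.even,
    c g₁ g₂ = f (𝔤.bracket g₁ g₂) - 𝔤.bracket g₁ (f g₂) + 𝔤.bracket g₂ (f g₁)) ∧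
  (∀ g ∈ 𝔤.even, ∀ h ∈ 𝔤.odd,
    c g h = f (𝔤.bracket g h) - 𝔤.bracket g (f h) + 𝔤.bracket h (f g)) ∧
  (∀ h₁ ∈ 𝔤.odd, ∀ h₂ ∈ 𝔤.odd,
    c h₁ h₂ = f (𝔤.bracket h₁ h₂) - 𝔤.bracket h₁ (f h₂) - 𝔤.bracket h₂ (f h₁))

/-- `IsClosed 𝔤 c` says `d c = 0`, for the differential `d : C²(𝔤; 𝔤) → C³(𝔤; 𝔤)`. The four
clauses are the vanishing of the components of `d c` on `Λ³𝔤₀`, `Λ²𝔤₀ ⊗ 𝔤₁`, `𝔤₀ ⊗ S²𝔤₁`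
and `S³𝔤₁`. -/
def IsClosed (𝔤 : LieSuperalgebra K V) (c : V →ₗ[K] V →ₗ[K] V) : Prop :=
  (∀ g₁ ∈ 𝔤.even, ∀ g₂ ∈ 𝔤.even, ∀ g₃ ∈ 𝔤.even,
    c (𝔤.bracket g₁ g₂) g₃ - c (𝔤.bracket g₁ g₃) g₂ + c (𝔤.bracket g₂ g₃) g₁
      - 𝔤.bracket g₁ (c g₂ g₃) + 𝔤.bracket g₂ (c g₁ g₃) - 𝔤.bracket g₃ (c g₁ g₂) = 0) ∧
  (∀ g₁ ∈ 𝔤.even, ∀ g₂ ∈ 𝔤.even, ∀ h ∈ 𝔤.odd,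
    c (𝔤.bracket g₁ g₂) h + c g₂ (𝔤.bracket g₁ h) - c g₁ (𝔤.bracket g₂ h)
      - 𝔤.bracket g₁ (c g₂ h) + 𝔤.bracket g₂ (c g₁ h) - 𝔤.bracket h (c g₁ g₂) = 0) ∧
  (∀ g ∈ 𝔤.even, ∀ h₁ ∈ 𝔤.odd, ∀ h₂ ∈ 𝔤.odd,
    c (𝔤.bracket g h₁) h₂ + c (𝔤.bracket g h₂) h₁ + c (𝔤.bracket h₁ h₂) g
      - 𝔤.bracket g (c h₁ h₂) + 𝔤.bracket h₁ (c g h₂) + 𝔤.bracket h₂ (c g h₁) = 0) ∧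
  (∀ h₁ ∈ 𝔤.odd, ∀ h₂ ∈ 𝔤.odd, ∀ h₃ ∈ 𝔤.odd,
    c (𝔤.bracket h₁ h₂) h₃ + c (𝔤.bracket h₁ h₃) h₂ + c (𝔤.bracket h₂ h₃) h₁
      - 𝔤.bracket h₁ (c h₂ h₃) - 𝔤.bracket h₂ (c h₁ h₃) - 𝔤.bracket h₃ (c h₁ h₂) = 0)

/-- The space `Z²(𝔤; 𝔤)` of 2-cocycles. -/
def Z2 (𝔤 : LieSuperalgebra K V) : Submodule K (V →ₗ[K] V →ₗ[K] V) where
  carrier := {c | c ∈ 𝔤.C2 ∧ 𝔤.IsClosed c}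
  zero_mem' := ⟨𝔤.C2.zero_mem, by simp [IsClosed]⟩
  add_mem' := by
    rintro a b ⟨ha, a1, a2, a3, a4⟩ ⟨hb, b1, b2, b3, b4⟩
    refine ⟨𝔤.C2.add_mem ha hb, fun x hx y hy z hz => ?_, fun x hx y hy z hz => ?_,
      fun x hx y hy z hz => ?_, fun x hx y hy z hz => ?_⟩
    · simp only [LinearMap.add_apply, map_add]
      linear_combination (norm := module) a1 x hx y hy z hz + b1 x hx y hy z hz
    · simp only [LinearMap.add_apply, map_add]
      linear_combination (norm := module) a2 x hx y hy z hz + b2 x hx y hy z hz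
    · simp only [LinearMap.add_apply, map_add]
      linear_combination (norm := module) a3 x hx y hy z hz + b3 x hx y hy z hz
    · simp only [LinearMap.add_apply, map_add]
      linear_combination (norm := module) a4 x hx y hy z hz + b4 x hx y hy z hz
  smul_mem' := by
    rintro r a ⟨ha, a1, a2, a3, a4⟩
    refine ⟨𝔤.C2.smul_mem r ha, fun x hx y hy z hz => ?_, fun x hx y hy z hz => ?_,
      fun x hx y hy z hz => ?_, fun x hx y hy z hz => ?_⟩
    · simpa only [smul_add, smul_sub, smul_zero, LinearMap.smul_apply, map_smul] using
        congrArg (r • ·) (a1 x hx y hy z hz)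
    · simpa only [smul_add, smul_sub, smul_zero, LinearMap.smul_apply, map_smul] using
        congrArg (r • ·) (a2 x hx y hy z hz)
    · simpa only [smul_add, smul_sub, smul_zero, LinearMap.smul_apply, map_smul] using
        congrArg (r • ·) (a3 x hx y hy z hz)
    · simpa only [smul_add, smul_sub, smul_zero, LinearMap.smul_apply, map_smul] using
        congrArg (r • ·) (a4 x hx y hy z hz)

/-- The space `B²(𝔤; 𝔤)` of 2-coboundaries. -/
def B2 (𝔤 : LieSuperalgebra K V) : Submodule K (V →ₗ[K] V →ₗ[K] V) where
  carrier := {c | c ∈ 𝔤.C2 ∧ ∃ f : V →ₗ[K] V, 𝔤.IsCoboundaryOf f c}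
  zero_mem' := ⟨𝔤.C2.zero_mem, 0, by simp [IsCoboundaryOf]⟩
  add_mem' := by
    rintro a b ⟨ha, f, a1, a2, a3⟩ ⟨hb, f', b1, b2, b3⟩
    refine ⟨𝔤.C2.add_mem ha hb, f + f', fun x hx y hy => ?_, fun x hx y hy => ?_,
      fun x hx y hy => ?_⟩
    · simp only [LinearMap.add_apply, map_add, a1 x hx y hy, b1 x hx y hy]; abel
    · simp only [LinearMap.add_apply, map_add, a2 x hx y hy, b2 x hx y hy]; abel
    · simp only [LinearMap.add_apply, map_add, a3 x hx y hy, b3 x hx y hy]; abel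
  smul_mem' := by
    rintro r a ⟨ha, f, a1, a2, a3⟩
    refine ⟨𝔤.C2.smul_mem r ha, r • f, fun x hx y hy => ?_, fun x hx y hy => ?_,
      fun x hx y hy => ?_⟩
    · simp only [LinearMap.smul_apply, map_smul, a1 x hx y hy, smul_add, smul_sub]
    · simp only [LinearMap.smul_apply, map_smul, a2 x hx y hy, smul_add, smul_sub]
    · simp only [LinearMap.smul_apply, map_smul, a3 x hx y hy, smul_sub]

/-- `d ∘ d = 0`, so that `B²(𝔤; 𝔤)` is a subspace of `Z²(𝔤; 𝔤)`. -/
theorem B2_le_Z2 (𝔤 : LieSuperalgebra K V) : 𝔤.B2 ≤ 𝔤.Z2 := by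
  have key : ∀ α β : ZMod 2, ∀ x ∈ 𝔤.part α, ∀ y ∈ 𝔤.part β, ∀ v : V,
      𝔤.bracket (𝔤.bracket x y) v = 𝔤.bracket x (𝔤.bracket y v) -
        (-1 : K) ^ (α.val * β.val) • 𝔤.bracket y (𝔤.bracket x v) := by
    intro α β x hx y hy v
    have hv : v ∈ ⨆ i, 𝔤.part i := by
      rw [𝔤.isInternal.submodule_iSup_eq_top]; trivial
    induction hv using Submodule.iSup_induction' with
    | zero => simp
    | add u w _ _ hu hw => simp only [map_add, hu, hw, smul_add]; abel
    | mem γ z hz =>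
      have hj := 𝔤.jacobi α β γ x hx y hy z hz
      rw [𝔤.skew γ α z hz x hx, 𝔤.skew γ (α + β) z hz _ (𝔤.bracket_mem α β x hx y hy)] at hj
      have h01 (δ : ZMod 2) : δ = 0 ∨ δ = 1 := by revert δ; decide
      have h2 : (1 : ZMod 2) + 1 = 0 := rfl
      rcases h01 α with rfl | rfl <;> rcases h01 β with rfl | rfl <;>
        rcases h01 γ with rfl | rfl <;>
        simp [ZMod.val_one, h2] at hj ⊢ <;>
        first
          | linear_combination (norm := module) -hj
          | linear_combination (norm := module) hj
  rintro c ⟨hc, f, f1, f2, f3⟩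
  obtain ⟨c1, c2, c3⟩ := hc
  have m00 : ∀ x ∈ 𝔤.even, ∀ y ∈ 𝔤.even, 𝔤.bracket x y ∈ 𝔤.even := fun x hx y hy =>
    𝔤.bracket_mem 0 0 x hx y hy
  have m01 : ∀ x ∈ 𝔤.even, ∀ y ∈ 𝔤.odd, 𝔤.bracket x y ∈ 𝔤.odd := fun x hx y hy =>
    𝔤.bracket_mem 0 1 x hx y hy
  have m11 : ∀ x ∈ 𝔤.odd, ∀ y ∈ 𝔤.odd, 𝔤.bracket x y ∈ 𝔤.even := fun x hx y hy =>
    𝔤.bracket_mem 1 1 x hx y hy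
  have k00 : ∀ x ∈ 𝔤.even, ∀ y ∈ 𝔤.even, ∀ v, 𝔤.bracket (𝔤.bracket x y) v =
      𝔤.bracket x (𝔤.bracket y v) - 𝔤.bracket y (𝔤.bracket x v) := fun x hx y hy v => by
    simpa using key 0 0 x hx y hy v
  have k01 : ∀ x ∈ 𝔤.even, ∀ y ∈ 𝔤.odd, ∀ v, 𝔤.bracket (𝔤.bracket x y) v =
      𝔤.bracket x (𝔤.bracket y v) - 𝔤.bracket y (𝔤.bracket x v) := fun x hx y hy v => by
    simpa using key 0 1 x hx y hy v
  have k11 : ∀ x ∈ 𝔤.odd, ∀ y ∈ 𝔤.odd, ∀ v, 𝔤.bracket (𝔤.bracket x y) v =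
      𝔤.bracket x (𝔤.bracket y v) + 𝔤.bracket y (𝔤.bracket x v) := fun x hx y hy v => by
    simpa [ZMod.val_one] using key 1 1 x hx y hy v
  have s00 : ∀ x ∈ 𝔤.even, ∀ y ∈ 𝔤.even, 𝔤.bracket x y = -𝔤.bracket y x := fun x hx y hy => by
    simpa using 𝔤.skew 0 0 x hx y hy
  have s01 : ∀ x ∈ 𝔤.even, ∀ y ∈ 𝔤.odd, 𝔤.bracket y x = -𝔤.bracket x y := fun x hx y hy => by
    simpa using 𝔤.skew 1 0 y hy x hx
  have s11 : ∀ x ∈ 𝔤.odd, ∀ y ∈ 𝔤.odd, 𝔤.bracket x y = 𝔤.bracket y x := fun x hx y hy => by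
    simpa [ZMod.val_one] using 𝔤.skew 1 1 x hx y hy
  refine ⟨⟨c1, c2, c3⟩, fun x hx y hy z hz => ?_, fun x hx y hy z hz => ?_,
    fun x hx y hy z hz => ?_, fun x hx y hy z hz => ?_⟩
  · have J := congrArg f (k00 x hx y hy z)
    rw [f1 _ (m00 x hx y hy) z hz, f1 _ (m00 x hx z hz) y hy, f1 _ (m00 y hy z hz) x hx,
      f1 y hy z hz, f1 x hx z hz, f1 x hx y hy,
      s00 _ (m00 x hx z hz) y hy, s00 _ (m00 y hy z hz) x hx]
    simp only [map_add, map_sub, map_neg] at J ⊢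
    linear_combination (norm := module) J - k00 x hx y hy (f z) + k00 x hx z hz (f y)
      - k00 y hy z hz (f x)
  · have J := congrArg f (k00 x hx y hy z)
    rw [f2 _ (m00 x hx y hy) z hz, f2 y hy _ (m01 x hx z hz), f2 x hx _ (m01 y hy z hz),
      f2 y hy z hz, f2 x hx z hz, f1 x hx y hy]
    simp only [map_add, map_sub] at J ⊢
    linear_combination (norm := module) J - k00 x hx y hy (f z) + k01 x hx z hz (f y)
      - k01 y hy z hz (f x)
  · have J := congrArg f (k01 x hx y hy z)
    rw [f3 _ (m01 x hx y hy) z hz, f3 _ (m01 x hx z hz) y hy, f1 _ (m11 y hy z hz) x hx,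
      f3 y hy z hz, f2 x hx z hz, f2 x hx y hy,
      s11 _ (m01 x hx z hz) y hy, s00 _ (m11 y hy z hz) x hx]
    simp only [map_add, map_sub, map_neg] at J ⊢
    linear_combination (norm := module) J - k01 x hx y hy (f z) - k01 x hx z hz (f y)
      - k11 y hy z hz (f x)
  · have J := congrArg f (k11 x hx y hy z)
    have t1 := s01 _ (m11 x hx z hz) y hy
    have t2 := s01 _ (m11 y hy z hz) x hx
    rw [t1, t2] at J
    rw [f2 _ (m11 x hx y hy) z hz, f2 _ (m11 x hx z hz) y hy, f2 _ (m11 y hy z hz) x hx,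
      f3 y hy z hz, f3 x hx z hz, f3 x hx y hy]
    simp only [map_add, map_sub, map_neg] at J ⊢
    linear_combination (norm := module) J - k11 x hx y hy (f z) - k11 x hx z hz (f y)
      - k11 y hy z hz (f x)

/-- The second cohomology space `H²(𝔤; 𝔤) = Z²(𝔤; 𝔤) / B²(𝔤; 𝔤)`. -/
abbrev H2 (𝔤 : LieSuperalgebra K V) : Type _ := 𝔤.Z2 ⧸ 𝔤.B2.submoduleOf 𝔤.Z2

/-- A Lie superalgebra is (cohomologically) rigid if `H²(𝔤; 𝔤) = 0`. -/
def IsRigid (𝔤 : LieSuperalgebra K V) : Prop := Subsingleton 𝔤.H2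

end LieSuperalgebra

/-- Index set of the basis `X₁, …, Xₙ, T₁, T₂, T₃, Y₁, …, Yₘ` (zero-based in each block). -/
abbrev SLIndex (n m : ℕ) : Type := Fin n ⊕ Fin 3 ⊕ Fin m

/-- The underlying vector space of `SL^{n,m}`. -/
abbrev SLSpace (K : Type*) (n m : ℕ) : Type _ := SLIndex n m → K

namespace SLSpace

variable (K : Type*) [Field K] (n m : ℕ)

/-- The basis vector `X_i`, `1 ≤ i ≤ n` (and `0` for other `i`). -/
def X (i : ℕ) : SLSpace K n m
  | .inl k => if (k : ℕ) + 1 = i then 1 else 0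
  | .inr _ => 0

/-- The basis vector `Y_j`, `1 ≤ j ≤ m` (and `0` for other `j`). -/
def Y (j : ℕ) : SLSpace K n m
  | .inl _ => 0
  | .inr (.inl _) => 0
  | .inr (.inr k) => if (k : ℕ) + 1 = j then 1 else 0

/-- The listed non-zero brackets, in the listed order of the arguments:
`[X₁, X_i] = X_{i+1}` (`2 ≤ i`), `[X₁, Y_j] = Y_{j+1}`, `[T₁, X_i] = i X_i`, `[T₂, X_i] = X_i`
(`2 ≤ i`), `[T₁, Y_j] = j Y_j`, `[T₃, Y_j] = Y_j`, with `X_{n+1} = 0 = Y_{m+1}`.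
The zero-based index `i` stands for `X_{i+1}`, and similarly for `Y` and `T`. -/
def listed : SLIndex n m → SLIndex n m → SLSpace K n m
  | .inl i, .inl j => if (i : ℕ) = 0 ∧ 1 ≤ (j : ℕ) then X K n m (j + 2) else 0
  | .inl i, .inr (.inr j) => if (i : ℕ) = 0 then Y K n m (j + 2) else 0
  | .inr (.inl l), .inl i =>
      if l = 0 then ((i : ℕ) + 1 : K) • X K n m (i + 1)
      else if l = 1 ∧ 1 ≤ (i : ℕ) then X K n m (i + 1) else 0
  | .inr (.inl l), .inr (.inr j) =>
      if l = 0 then ((j : ℕ) + 1 : K) • Y K n m (j + 1)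
      else if l = 2 then Y K n m (j + 1) else 0
  | _, _ => 0

/-- The bracket: the bilinear map whose value on two basis vectors `a, b` is the listed bracket
`[a, b]`, or minus the listed bracket `[b, a]` (at most one of the two is listed), or `0`.
No bracket of two odd vectors is listed, so this is the super skew-symmetric extension. -/
noncomputable def bracket : SLSpace K n m →ₗ[K] SLSpace K n m →ₗ[K] SLSpace K n m :=
  (Pi.basisFun K (SLIndex n m)).constr K fun a =>
    (Pi.basisFun K (SLIndex n m)).constr K fun b => listed K n m a b - listed K n m b a

/-- The grading: `X_i, T_l` span the even part and `Y_j` span the odd part. -/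
def part (α : ZMod 2) : Submodule K (SLSpace K n m) where
  carrier := {v | (α = 0 → ∀ j, v (.inr (.inr j)) = 0) ∧
    (α = 1 → (∀ i, v (.inl i) = 0) ∧ ∀ l, v (.inr (.inl l)) = 0)}
  zero_mem' := by simp
  add_mem' := by
    rintro a b ⟨a1, a2⟩ ⟨b1, b2⟩
    refine ⟨fun h j => by simp [a1 h j, b1 h j], fun h => ⟨fun i => ?_, fun l => ?_⟩⟩
    · simp [(a2 h).1 i, (b2 h).1 i]
    · simp [(a2 h).2 l, (b2 h).2 l]
  smul_mem' := by
    rintro r a ⟨a1, a2⟩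
    refine ⟨fun h j => by simp [a1 h j], fun h => ⟨fun i => ?_, fun l => ?_⟩⟩
    · simp [(a2 h).1 i]
    · simp [(a2 h).2 l]

theorem bracket_single (a b : SLIndex n m) :
    bracket K n m (Pi.single a 1) (Pi.single b 1) = listed K n m a b - listed K n m b a := by
  have h : ∀ c : SLIndex n m, (Pi.single c 1 : SLSpace K n m) = Pi.basisFun K _ c := fun c =>
    (Pi.basisFun_apply K _ c).symm
  rw [h a, h b, bracket, Module.Basis.constr_basis, Module.Basis.constr_basis]

theorem X_succ (i : Fin n) : X K n m (i + 1) = Pi.single (.inl i) 1 := by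
  funext k
  rcases k with k | k
  · simp [X, Pi.single_apply, Fin.ext_iff]
  · simp [X]

theorem Y_succ (j : Fin m) : Y K n m (j + 1) = Pi.single (.inr (.inr j)) 1 := by
  funext k
  rcases k with k | k | k
  · simp [Y]
  · simp [Y]
  · simp [Y, Pi.single_apply, Fin.ext_iff]

theorem X_cases (i : ℕ) : X K n m i = 0 ∨ ∃ k : Fin n, (k : ℕ) + 1 = i := by
  by_cases h : ∃ k : Fin n, (k : ℕ) + 1 = i
  · exact Or.inr h
  · left
    push Not at h
    funext k
    rcases k with k | k
    · simp [X, h k]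
    · rfl

theorem Y_cases (j : ℕ) : Y K n m j = 0 ∨ ∃ k : Fin m, (k : ℕ) + 1 = j := by
  by_cases h : ∃ k : Fin m, (k : ℕ) + 1 = j
  · exact Or.inr h
  · left
    push Not at h
    funext k
    rcases k with k | k | k
    · rfl
    · rfl
    · simp [Y, h k]

/-- Skew-symmetry without signs. -/
theorem bracket_comm (x y : SLSpace K n m) : bracket K n m x y = -bracket K n m y x := by
  have : bracket K n m = -(bracket K n m).flip := by
    refine (Pi.basisFun K _).ext fun a => (Pi.basisFun K _).ext fun b => ?_
    simp [bracket_single]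
  exact congrArg (fun f => f x y) this

theorem bracket_X_X (i : Fin n) (j : ℕ) (hj : 2 ≤ j) :
    bracket K n m (Pi.single (.inl i) 1) (X K n m j) =
      if (i : ℕ) = 0 then X K n m (j + 1) else 0 := by
  rcases X_cases K n m j with h | ⟨k, rfl⟩
  · have h' : X K n m (j + 1) = 0 := by
      rcases X_cases K n m (j + 1) with h' | ⟨k, hk⟩
      · exact h'
      · obtain ⟨l, rfl⟩ : ∃ l, j = l + 1 := ⟨j - 1, by omega⟩
        have := congrFun h (.inl ⟨l, by omega⟩)
        simp [X] at this
    simp [h, h']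
  · rw [X_succ, bracket_single]
    have : (k : ℕ) ≠ 0 := by omega
    have h1 : 1 ≤ (k : ℕ) := by omega
    simp [listed, this, h1]

theorem bracket_X_Y (i : Fin n) (j : ℕ) (hj : 1 ≤ j) :
    bracket K n m (Pi.single (.inl i) 1) (Y K n m j) =
      if (i : ℕ) = 0 then Y K n m (j + 1) else 0 := by
  rcases Y_cases K n m j with h | ⟨k, rfl⟩
  · have h' : Y K n m (j + 1) = 0 := by
      rcases Y_cases K n m (j + 1) with h' | ⟨k, hk⟩
      · exact h'
      · obtain ⟨l, rfl⟩ : ∃ l, j = l + 1 := ⟨j - 1, by omega⟩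
        have := congrFun h (.inr (.inr ⟨l, by omega⟩))
        simp [Y] at this
    simp [h, h']
  · rw [Y_succ, bracket_single]
    simp [listed]

/-- The weight of `X_i` under `T_l`. -/
def wX (l : Fin 3) (i : ℕ) : K := if l = 0 then (i : K) else if l = 1 ∧ 2 ≤ i then 1 else 0

/-- The weight of `Y_j` under `T_l`. -/
def wY (l : Fin 3) (j : ℕ) : K := if l = 0 then (j : K) else if l = 2 then 1 else 0

theorem bracket_T_X (l : Fin 3) (i : ℕ) :
    bracket K n m (Pi.single (.inr (.inl l)) 1) (X K n m i) = wX K l i • X K n m i := by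
  rcases X_cases K n m i with h | ⟨k, rfl⟩
  · simp [h]
  · rw [X_succ, bracket_single]
    simp only [listed, ← X_succ, wX]
    split_ifs <;> simp_all

theorem bracket_T_Y (l : Fin 3) (j : ℕ) :
    bracket K n m (Pi.single (.inr (.inl l)) 1) (Y K n m j) = wY K l j • Y K n m j := by
  rcases Y_cases K n m j with h | ⟨k, rfl⟩
  · simp [h]
  · rw [Y_succ, bracket_single]
    simp only [listed, ← Y_succ, wY]
    split_ifs <;> simp

theorem bracket_T_T (l l' : Fin 3) : bracket K n m (Pi.single (.inr (.inl l)) 1)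
    (Pi.single (.inr (.inl l')) 1) = 0 := by
  rw [bracket_single]; simp [listed]

theorem bracket_Y_Y (i : Fin m) (j : ℕ) :
    bracket K n m (Pi.single (.inr (.inr i)) 1) (Y K n m j) = 0 := by
  rcases Y_cases K n m j with h | ⟨k, rfl⟩
  · simp [h]
  · rw [Y_succ, bracket_single]; simp [listed]

theorem bracket_self (x : SLSpace K n m) (a : SLIndex n m) (h : x = Pi.single a 1) :
    bracket K n m x x = 0 := by
  rw [h, bracket_single, sub_self]

theorem jacobi_TT (l l' : Fin 3) (v : SLSpace K n m) (a b : K)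
    (h : bracket K n m (Pi.single (.inr (.inl l)) 1) v = a • v)
    (h' : bracket K n m (Pi.single (.inr (.inl l')) 1) v = b • v) :
    bracket K n m (Pi.single (.inr (.inl l)) 1) (bracket K n m (Pi.single (.inr (.inl l')) 1) v) +
      bracket K n m (Pi.single (.inr (.inl l')) 1)
        (bracket K n m v (Pi.single (.inr (.inl l)) 1)) +
      bracket K n m v
        (bracket K n m (Pi.single (.inr (.inl l)) 1) (Pi.single (.inr (.inl l')) 1)) = 0 := by
  rw [bracket_comm K n m v (Pi.single (.inr (.inl l)) 1), bracket_T_T, h, h']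
  simp only [map_smul, map_neg, map_zero, h, h']
  module

theorem jacobi_T (l : Fin 3) (u v : SLSpace K n m) (a b : K)
    (hu : bracket K n m (Pi.single (.inr (.inl l)) 1) u = a • u)
    (hv : bracket K n m (Pi.single (.inr (.inl l)) 1) v = b • v)
    (huv : bracket K n m (Pi.single (.inr (.inl l)) 1) (bracket K n m u v) =
      (a + b) • bracket K n m u v) :
    bracket K n m (Pi.single (.inr (.inl l)) 1) (bracket K n m u v) +
      bracket K n m u (bracket K n m v (Pi.single (.inr (.inl l)) 1)) +
      bracket K n m v (bracket K n m (Pi.single (.inr (.inl l)) 1) u) = 0 := by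
  rw [bracket_comm K n m v (Pi.single (.inr (.inl l)) 1), huv, hu, hv]
  simp only [map_smul, map_neg, bracket_comm K n m v u]
  module

/-- The Jacobi identity without signs, on basis vectors. -/
theorem jacobi_basis (a b c : SLIndex n m) :
    bracket K n m (Pi.single a 1) (bracket K n m (Pi.single b 1) (Pi.single c 1)) +
      bracket K n m (Pi.single b 1) (bracket K n m (Pi.single c 1) (Pi.single a 1)) +
      bracket K n m (Pi.single c 1) (bracket K n m (Pi.single a 1) (Pi.single b 1)) = 0 := by
  set P : SLIndex n m → SLIndex n m → SLIndex n m → Prop := fun a b c =>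
    bracket K n m (Pi.single a 1) (bracket K n m (Pi.single b 1) (Pi.single c 1)) +
      bracket K n m (Pi.single b 1) (bracket K n m (Pi.single c 1) (Pi.single a 1)) +
      bracket K n m (Pi.single c 1) (bracket K n m (Pi.single a 1) (Pi.single b 1)) = 0 with hP
  have cyc : ∀ a b c, P a b c → P b c a := fun a b c h => by
    simp only [hP] at h ⊢; rw [← h]; abel
  have swap : ∀ a b c, P a b c → P b a c := fun a b c h => by
    simp only [hP] at h ⊢
    rw [bracket_comm K n m (Pi.single a 1) (Pi.single c 1),
      bracket_comm K n m (Pi.single c 1) (Pi.single b 1),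
      bracket_comm K n m (Pi.single b 1) (Pi.single a 1)]
    simp only [map_neg]
    rw [← neg_eq_zero, ← h]; abel
  have yy : ∀ i j : Fin m, bracket K n m (Pi.single (.inr (.inr i)) 1)
      (Pi.single (.inr (.inr j)) 1) = 0 := fun i j => by
    rw [bracket_single]; simp [listed]
  have TTX : ∀ l l' i, P (.inr (.inl l)) (.inr (.inl l')) (.inl i) := fun l l' i =>
    jacobi_TT K n m l l' _ _ _ (by rw [← X_succ]; exact bracket_T_X K n m l _)
      (by rw [← X_succ]; exact bracket_T_X K n m l' _)
  have TTY : ∀ l l' j, P (.inr (.inl l)) (.inr (.inl l')) (.inr (.inr j)) := fun l l' i =>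
    jacobi_TT K n m l l' _ _ _ (by rw [← Y_succ]; exact bracket_T_Y K n m l _)
      (by rw [← Y_succ]; exact bracket_T_Y K n m l' _)
  have TTT : ∀ l l' l'', P (.inr (.inl l)) (.inr (.inl l')) (.inr (.inl l'')) :=
    fun l l' l'' => by simp [hP, bracket_T_T]
  have TXX' : ∀ l (i j : Fin n), 1 ≤ (j : ℕ) → P (.inr (.inl l)) (.inl i) (.inl j) := by
    intro l i j hj
    refine jacobi_T K n m l _ _ (wX K l (i + 1)) (wX K l (j + 1))
      (by rw [← X_succ]; exact bracket_T_X K n m l _)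
      (by rw [← X_succ]; exact bracket_T_X K n m l _) ?_
    rw [← X_succ K n m j, bracket_X_X K n m i _ (by omega)]
    split_ifs with h
    · rw [bracket_T_X]; congr 1
      have : (j : ℕ) ≠ 0 := by omega
      simp [wX, h, hj]
      split_ifs <;> ring
    · simp
  have TXX : ∀ l i j, P (.inr (.inl l)) (.inl i) (.inl j) := by
    intro l i j
    by_cases hj : 1 ≤ (j : ℕ)
    · exact TXX' l i j hj
    by_cases hi : 1 ≤ (i : ℕ)
    · exact cyc _ _ _ (cyc _ _ _ (swap _ _ _ (cyc _ _ _ (cyc _ _ _ (cyc _ _ _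
        (cyc _ _ _ (TXX' l j i hi)))))))
    · obtain rfl : i = j := Fin.ext (by omega)
      refine jacobi_T K n m l _ _ (wX K l (i + 1)) (wX K l (i + 1))
        (by rw [← X_succ]; exact bracket_T_X K n m l _)
        (by rw [← X_succ]; exact bracket_T_X K n m l _) ?_
      rw [bracket_self K n m _ _ rfl]; simp
  have TXY : ∀ l i j, P (.inr (.inl l)) (.inl i) (.inr (.inr j)) := by
    intro l i j
    refine jacobi_T K n m l _ _ (wX K l (i + 1)) (wY K l (j + 1))
      (by rw [← X_succ]; exact bracket_T_X K n m l _)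
      (by rw [← Y_succ]; exact bracket_T_Y K n m l _) ?_
    rw [← Y_succ K n m j, bracket_X_Y K n m i _ (by omega)]
    split_ifs with h
    · rw [bracket_T_Y]; congr 1
      simp [wX, wY, h]
      split_ifs <;> ring
    · simp
  have TYY : ∀ l i j, P (.inr (.inl l)) (.inr (.inr i)) (.inr (.inr j)) := by
    intro l i j
    refine jacobi_T K n m l _ _ (wY K l (i + 1)) (wY K l (j + 1))
      (by rw [← Y_succ]; exact bracket_T_Y K n m l _)
      (by rw [← Y_succ]; exact bracket_T_Y K n m l _) ?_
    rw [yy]; simp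
  have YYY : ∀ i j k, P (.inr (.inr i)) (.inr (.inr j)) (.inr (.inr k)) := by
    intro i j k; simp [hP, yy]
  have XYY : ∀ i j k, P (.inl i) (.inr (.inr j)) (.inr (.inr k)) := by
    intro i j k
    have h1 := bracket_X_Y K n m i (j + 1) (by omega)
    have h2 := bracket_X_Y K n m i (k + 1) (by omega)
    rw [Y_succ] at h1 h2
    simp only [hP]
    rw [yy, bracket_comm K n m (Pi.single (.inr (.inr k)) 1) (Pi.single (.inl i) 1), h1, h2]
    split_ifs <;> simp [bracket_Y_Y]
  have diag : ∀ a b, P a a b := by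
    intro a b
    simp only [hP]
    rw [bracket_self K n m _ a rfl, bracket_comm K n m (Pi.single b 1) (Pi.single a 1)]
    simp
  have XXY' : ∀ (i j : Fin n) k, 1 ≤ (j : ℕ) → P (.inl i) (.inl j) (.inr (.inr k)) := by
    intro i j k hj
    have h0 : (j : ℕ) ≠ 0 := by omega
    have h1 : ∀ q, 1 ≤ q → bracket K n m (Pi.single (.inl j) 1) (Y K n m q) = 0 := fun q hq => by
      rw [bracket_X_Y K n m j q hq, if_neg h0]
    have h2 : bracket K n m (Pi.single (.inr (.inr k)) 1)
        (bracket K n m (Pi.single (.inl i) 1) (Pi.single (.inl j) 1)) = 0 := by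
      rw [← X_succ K n m j, bracket_X_X K n m i _ (by omega)]
      split_ifs
      · rcases X_cases K n m (j + 1 + 1) with h | ⟨q, hq⟩
        · rw [h, map_zero]
        · rw [← hq, X_succ, bracket_comm, ← Y_succ, bracket_X_Y K n m q _ (by omega),
            if_neg (by omega), neg_zero]
      · exact map_zero _
    simp only [hP]
    rw [h2, bracket_comm K n m (Pi.single (.inr (.inr k)) 1) (Pi.single (.inl i) 1),
      ← Y_succ K n m k, h1 _ (by omega), bracket_X_Y K n m i _ (by omega)]
    split_ifs
    · simp [h1]
    · simp
  have XXY : ∀ i j k, P (.inl i) (.inl j) (.inr (.inr k)) := by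
    intro i j k
    by_cases hj : 1 ≤ (j : ℕ)
    · exact XXY' i j k hj
    by_cases hi : 1 ≤ (i : ℕ)
    · exact swap _ _ _ (XXY' j i k hi)
    · obtain rfl : i = j := Fin.ext (by omega)
      exact diag _ _
  have XXX' : ∀ i j k : Fin n, 1 ≤ (j : ℕ) → 1 ≤ (k : ℕ) → P (.inl i) (.inl j) (.inl k) := by
    intro i j k hj hk
    have h1 : ∀ r : Fin n, 1 ≤ (r : ℕ) → ∀ q, 2 ≤ q →
        bracket K n m (Pi.single (.inl r) 1) (X K n m q) = 0 := fun r hr q hq => by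
      rw [bracket_X_X K n m r q hq, if_neg (by omega)]
    simp only [hP]
    rw [bracket_comm K n m (Pi.single (.inl k) 1) (Pi.single (.inl i) 1),
      ← X_succ K n m k, ← X_succ K n m j, bracket_X_X K n m i _ (by omega),
      bracket_X_X K n m i _ (by omega), X_succ K n m j, h1 j hj _ (by omega),
      X_succ K n m k]
    split_ifs
    · simp [h1 j hj (k + 1 + 1) (by omega), h1 k hk (j + 1 + 1) (by omega)]
    · simp
  have XXX : ∀ i j k, P (.inl i) (.inl j) (.inl k) := by
    intro i j k
    by_cases hi : 1 ≤ (i : ℕ)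
    · by_cases hj : 1 ≤ (j : ℕ)
      · exact cyc _ _ _ (XXX' k i j hi hj)
      · by_cases hk : 1 ≤ (k : ℕ)
        · exact cyc _ _ _ (cyc _ _ _ (XXX' j k i hk hi))
        · obtain rfl : j = k := Fin.ext (by omega)
          exact cyc _ _ _ (cyc _ _ _ (diag _ _))
    · by_cases hj : 1 ≤ (j : ℕ)
      · by_cases hk : 1 ≤ (k : ℕ)
        · exact XXX' i j k hj hk
        · obtain rfl : k = i := Fin.ext (by omega)
          exact cyc _ _ _ (diag _ _)
      · obtain rfl : i = j := Fin.ext (by omega)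
        exact diag _ _
  change P a b c
  clear_value P
  rcases a with a | a | a <;> rcases b with b | b | b <;> rcases c with c | c | c <;>
    first
      | exact TTT _ _ _ | exact YYY _ _ _ | exact XXX _ _ _
      | exact TTX _ _ _ | exact cyc _ _ _ (TTX _ _ _) | exact cyc _ _ _ (cyc _ _ _ (TTX _ _ _))
      | exact TTY _ _ _ | exact cyc _ _ _ (TTY _ _ _) | exact cyc _ _ _ (cyc _ _ _ (TTY _ _ _))
      | exact TXX _ _ _ | exact cyc _ _ _ (TXX _ _ _) | exact cyc _ _ _ (cyc _ _ _ (TXX _ _ _))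
      | exact TYY _ _ _ | exact cyc _ _ _ (TYY _ _ _) | exact cyc _ _ _ (cyc _ _ _ (TYY _ _ _))
      | exact XXY _ _ _ | exact cyc _ _ _ (XXY _ _ _) | exact cyc _ _ _ (cyc _ _ _ (XXY _ _ _))
      | exact XYY _ _ _ | exact cyc _ _ _ (XYY _ _ _) | exact cyc _ _ _ (cyc _ _ _ (XYY _ _ _))
      | exact TXY _ _ _ | exact cyc _ _ _ (TXY _ _ _) | exact cyc _ _ _ (cyc _ _ _ (TXY _ _ _))
      | exact swap _ _ _ (TXY _ _ _) | exact swap _ _ _ (cyc _ _ _ (TXY _ _ _))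
      | exact swap _ _ _ (cyc _ _ _ (cyc _ _ _ (TXY _ _ _)))

/-- The Jacobi identity without signs. -/
theorem jacobi (x y z : SLSpace K n m) :
    bracket K n m x (bracket K n m y z) + bracket K n m y (bracket K n m z x) +
      bracket K n m z (bracket K n m x y) = 0 := by
  have top : ∀ v : SLSpace K n m,
      v ∈ Submodule.span K (Set.range (Pi.basisFun K (SLIndex n m))) := fun v => by
    rw [Module.Basis.span_eq]; trivial
  induction top x using Submodule.span_induction with
  | zero => simp
  | add u v _ _ hu hv =>
    simp only [map_add, LinearMap.add_apply]
    linear_combination (norm := module) hu + hv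
  | smul r u _ hu =>
    simp only [map_smul, LinearMap.smul_apply, ← smul_add, hu, smul_zero]
  | mem x hx =>
  induction top y using Submodule.span_induction with
  | zero => simp
  | add u v _ _ hu hv =>
    simp only [map_add, LinearMap.add_apply]
    linear_combination (norm := module) hu + hv
  | smul r u _ hu =>
    simp only [map_smul, LinearMap.smul_apply, ← smul_add, hu, smul_zero]
  | mem y hy =>
  induction top z using Submodule.span_induction with
  | zero => simp
  | add u v _ _ hu hv =>
    simp only [map_add, LinearMap.add_apply]
    linear_combination (norm := module) hu + hv
  | smul r u _ hu =>
    simp only [map_smul, LinearMap.smul_apply, ← smul_add, hu, smul_zero]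
  | mem z hz =>
  obtain ⟨a, rfl⟩ := hx
  obtain ⟨b, rfl⟩ := hy
  obtain ⟨c, rfl⟩ := hz
  simp only [Pi.basisFun_apply]
  exact jacobi_basis K n m a b c

theorem isInternal_part : DirectSum.IsInternal (part K n m) := by
  rw [DirectSum.isInternal_submodule_iff_isCompl _ (i := 0) (j := 1) (by decide)]
  · rw [isCompl_iff, Submodule.disjoint_def, codisjoint_iff_le_sup]
    constructor
    · rintro x ⟨h0, -⟩ ⟨-, h1⟩
      funext k
      rcases k with k | k | k
      · exact (h1 rfl).1 k
      · exact (h1 rfl).2 k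
      · exact h0 rfl k
    · intro x _
      rw [Submodule.mem_sup]
      refine ⟨fun | .inr (.inr _) => 0 | .inl i => x (.inl i) | .inr (.inl l) => x (.inr (.inl l)),
        ⟨fun _ _ => rfl, fun h => absurd h (by decide)⟩,
        fun | .inr (.inr j) => x (.inr (.inr j)) | .inl _ => 0 | .inr (.inl _) => 0,
        ⟨fun h => absurd h (by decide), fun _ => ⟨fun _ => rfl, fun _ => rfl⟩⟩, ?_⟩
      funext k
      rcases k with k | k | k <;> simp
  · ext a; revert a; decide

theorem bracket_apply (x y : SLSpace K n m) (k : SLIndex n m) :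
    bracket K n m x y k =
      ∑ a, ∑ b, x a * (y b * (listed K n m a b k - listed K n m b a k)) := by
  simp only [bracket, Module.Basis.constr_apply_fintype, Pi.basisFun_equivFun,
    LinearEquiv.refl_apply, LinearMap.sum_apply, Finset.sum_apply, LinearMap.smul_apply,
    Pi.smul_apply, Pi.sub_apply, smul_eq_mul, Finset.mul_sum]

theorem bracket_odd_odd (x : SLSpace K n m) (hx : x ∈ part K n m 1)
    (y : SLSpace K n m) (hy : y ∈ part K n m 1) : bracket K n m x y = 0 := by
  funext k
  obtain ⟨hx1, hx2⟩ := hx.2 rfl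
  obtain ⟨hy1, hy2⟩ := hy.2 rfl
  simp [bracket_apply, Fintype.sum_sum_type, hx1, hx2, hy1, hy2, listed]

theorem bracket_mem (α β : ZMod 2) (x : SLSpace K n m) (hx : x ∈ part K n m α)
    (y : SLSpace K n m) (hy : y ∈ part K n m β) : bracket K n m x y ∈ part K n m (α + β) := by
  have h01 (δ : ZMod 2) : δ = 0 ∨ δ = 1 := by revert δ; decide
  have odd : ∀ x ∈ part K n m 0, ∀ y ∈ part K n m 1, bracket K n m x y ∈ part K n m 1 := by
    intro x hx y hy
    have hx := hx.1 rfl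
    obtain ⟨hy1, hy2⟩ := hy.2 rfl
    refine ⟨fun h => absurd h (by decide), fun _ => ⟨fun i => ?_, fun l => ?_⟩⟩ <;>
      simp [bracket_apply, Fintype.sum_sum_type, hx, hy1, hy2, listed, Y, ite_apply]
  rcases h01 α with rfl | rfl <;> rcases h01 β with rfl | rfl
  · have hx := hx.1 rfl
    have hy := hy.1 rfl
    refine ⟨fun _ j => ?_, fun h => absurd h (by decide)⟩
    simp [bracket_apply, Fintype.sum_sum_type, hx, hy, listed, X, Y, ite_apply]
  · exact odd x hx y hy
  · rw [bracket_comm]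
    exact neg_mem (odd y hy x hx)
  · rw [bracket_odd_odd K n m x hx y hy]
    exact zero_mem _

end SLSpace

/-- The solvable Lie superalgebra `SL^{n,m}` over `K`, with even basis `X₁, …, Xₙ, T₁, T₂, T₃`
and odd basis `Y₁, …, Yₘ`. -/
noncomputable def SL (K : Type*) [Field K] (n m : ℕ) : LieSuperalgebra K (SLSpace K n m) where
  part := SLSpace.part K n m
  isInternal := SLSpace.isInternal_part K n m
  bracket := SLSpace.bracket K n m
  bracket_mem := SLSpace.bracket_mem K n m
  skew := by
    have h01 (δ : ZMod 2) : δ = 0 ∨ δ = 1 := by revert δ; decide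
    intro α β x hx y hy
    rcases h01 α with rfl | rfl <;> rcases h01 β with rfl | rfl
    · simpa using SLSpace.bracket_comm K n m x y
    · simpa using SLSpace.bracket_comm K n m x y
    · simpa using SLSpace.bracket_comm K n m x y
    · simp [SLSpace.bracket_odd_odd K n m x hx y hy, SLSpace.bracket_odd_odd K n m y hy x hx]
  jacobi := by
    have h01 (δ : ZMod 2) : δ = 0 ∨ δ = 1 := by revert δ; decide
    intro α β γ x hx y hy z hz
    have J := SLSpace.jacobi K n m x y z
    have o := SLSpace.bracket_odd_odd K n m
    have me : ∀ δ, ∀ u ∈ SLSpace.part K n m δ, ∀ v ∈ SLSpace.part K n m (δ + 1),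
        SLSpace.bracket K n m u v ∈ SLSpace.part K n m 1 := fun δ u hu v hv => by
      have := SLSpace.bracket_mem K n m _ _ u hu v hv
      rwa [← add_assoc, CharTwo.add_self_eq_zero, zero_add] at this
    rcases h01 α with rfl | rfl <;> rcases h01 β with rfl | rfl <;> rcases h01 γ with rfl | rfl
    · simpa using J
    · simpa using J
    · simpa using J
    · have h1 := o y hy z hz
      have h2 := o y hy _ (me 1 z hz x hx)
      have h3 := o z hz _ (me 0 x hx y hy)
      simp [h1, h2, h3]
    · simpa using J
    · have h1 := o z hz x hx
      have h2 := o x hx _ (me 0 y hy z hz)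
      have h3 := o z hz _ (me 1 x hx y hy)
      simp [h1, h2, h3]
    · have h1 := o x hx y hy
      have h2 := o x hx _ (me 1 y hy z hz)
      have h3 := o y hy _ (me 0 z hz x hx)
      simp [h1, h2, h3]
    · simp [o x hx y hy, o y hy z hz, o z hz x hx]

/-! The elements `T₁, T₂, T₃` span a torus acting diagonally on the given basis, hence on cochains,
with all weights in the prime field. By Cartan's formula the Lie derivative `L_t` of a cocycle along
an even element is a coboundary. A weight `w` in the prime field satisfies `w ^ (p - 1) = 1` or `w =
0`, so `L_t ^ (p - 1)`, for `t` one of the `T_l`, is the projection onto the components of nonzero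
`t`-weight. Subtracting it changes a cocycle by a coboundary and leaves the part of `t`-weight zero.
Doing this for the three `T_l` gives `exists_weight_zero`: every class has a representative of
weight zero.

A weight-zero cocycle has little room. The joint weights of the `X_i` and `Y_j` are nonzero and
pairwise distinct, so `c(T_l, ·)` is diagonal on them, `c(X₁, X_i)` for `i ≥ 2` is a multiple of
`X_{i+1}`, and `c(X₁, Y_j)` is a multiple of `Y_{j+1}`. Two arguments among `X₂, …, Xₙ, Y₁, …, Yₘ`
give zero, since no basis vector has the sum of their `(T₂, T₃)`-weights; this needs `2 ≠ 0`. The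
cocycle identity then forces `c(T_s, T_t) = 0` (`apply_T_T`) and makes `c(T_l, ·)` act on the `X_i`
and `Y_j` as the adjoint action of a torus element (`exists_torus`).

Such a cocycle is the coboundary of a map preserving the torus and diagonal on the remaining basis
vectors (`IsWeightZero.mem_B2`). Its values on the `T_l` account for `c(T_l, ·)`, and its
eigenvalues on the `X_i` and `Y_j` are partial sums of the coefficients of `c(X₁, ·)`. -/

set_option maxSynthPendingDepth 3

/-! ### Lie derivatives of cocycles and Cartan's formula -/

namespace LieSuperalgebra

variable {K V : Type*} [Field K] [AddCommGroup V] [Module K V]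

/-- The Lie derivative of a 2-cochain along `t`. -/
def lieDeriv (𝔤 : LieSuperalgebra K V) (t : V) (c : V →ₗ[K] V →ₗ[K] V) : V →ₗ[K] V →ₗ[K] V :=
  c.compr₂ (𝔤.bracket t) - c ∘ₗ 𝔤.bracket t - c.compl₂ (𝔤.bracket t)

@[simp]
theorem lieDeriv_apply (𝔤 : LieSuperalgebra K V) (t : V) (c : V →ₗ[K] V →ₗ[K] V) (x y : V) :
    𝔤.lieDeriv t c x y = 𝔤.bracket t (c x y) - c (𝔤.bracket t x) y - c x (𝔤.bracket t y) := rfl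

theorem C2_even_skew {𝔤 : LieSuperalgebra K V} {c : V →ₗ[K] V →ₗ[K] V} (hc : c ∈ 𝔤.C2)
    {x y : V} (hx : x ∈ 𝔤.even) (hy : y ∈ 𝔤.even) : c x y = -c y x := by
  have h := hc.1 (x + y) (add_mem hx hy)
  simp only [map_add, LinearMap.add_apply, hc.1 x hx, hc.1 y hy, zero_add, add_zero] at h
  exact eq_neg_of_add_eq_zero_right h

/-- Cartan's homotopy formula: the Lie derivative of a cocycle along an even element is the
coboundary of (minus) its contraction. -/
theorem lieDeriv_mem_B2 {𝔤 : LieSuperalgebra K V} {c : V →ₗ[K] V →ₗ[K] V} (hc : c ∈ 𝔤.Z2)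
    {t : V} (ht : t ∈ 𝔤.even) : 𝔤.lieDeriv t c ∈ 𝔤.B2 := by
  obtain ⟨hC, z1, z2, z3, -⟩ := hc
  have m0 : ∀ x ∈ 𝔤.even, 𝔤.bracket t x ∈ 𝔤.even := fun x hx => 𝔤.bracket_mem 0 0 t ht x hx
  have m1 : ∀ x ∈ 𝔤.odd, 𝔤.bracket t x ∈ 𝔤.odd := fun x hx => 𝔤.bracket_mem 0 1 t ht x hx
  have m00 : ∀ x ∈ 𝔤.even, ∀ y ∈ 𝔤.even, 𝔤.bracket x y ∈ 𝔤.even := fun x hx y hy =>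
    𝔤.bracket_mem 0 0 x hx y hy
  have m11 : ∀ x ∈ 𝔤.odd, ∀ y ∈ 𝔤.odd, 𝔤.bracket x y ∈ 𝔤.even := fun x hx y hy =>
    𝔤.bracket_mem 1 1 x hx y hy
  obtain ⟨-, c2, c3⟩ := id hC
  refine ⟨⟨fun g hg => ?_, fun g hg h hh => ?_, fun h hh h' hh' => ?_⟩,
    -(c t), fun x hx y hy => ?_, fun x hx y hy => ?_, fun x hx y hy => ?_⟩
  · rw [lieDeriv_apply, hC.1 g hg, C2_even_skew hC hg (m0 g hg)]
    simp
  · rw [lieDeriv_apply, lieDeriv_apply, c2 g hg h hh, c2 g hg _ (m1 h hh), c2 _ (m0 g hg) h hh]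
    simp only [map_neg]
    module
  · rw [lieDeriv_apply, lieDeriv_apply, c3 h hh h' hh', c3 _ (m1 h hh) h' hh',
      c3 h hh _ (m1 h' hh')]
    module
  -- The identity `(dc)(t, x, y) = 0` is already Cartan's formula once skew-symmetry has brought its
  -- terms into the order of arguments used in `L_t c` and in the coboundary.
  · have h := z1 t ht x hx y hy
    rw [C2_even_skew hC (m0 y hy) hx, C2_even_skew hC (m00 x hx y hy) ht] at h
    simp only [lieDeriv_apply, LinearMap.neg_apply, map_neg]
    linear_combination (norm := module) -h
  · have h := z2 t ht x hx y hy
    simp only [lieDeriv_apply, LinearMap.neg_apply, map_neg]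
    linear_combination (norm := module) -h
  · have h := z3 t ht x hx y hy
    rw [c3 _ (m1 y hy) x hx, C2_even_skew hC (m11 x hx y hy) ht] at h
    simp only [lieDeriv_apply, LinearMap.neg_apply, map_neg]
    linear_combination (norm := module) -h

theorem lieDeriv_iterate_mem_B2 {𝔤 : LieSuperalgebra K V} {c : V →ₗ[K] V →ₗ[K] V}
    (hc : c ∈ 𝔤.Z2) {t : V} (ht : t ∈ 𝔤.even) (q : ℕ) :
    (𝔤.lieDeriv t)^[q + 1] c ∈ 𝔤.B2 := by
  induction q with
  | zero => exact lieDeriv_mem_B2 hc ht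
  | succ q ih =>
    rw [Function.iterate_succ_apply']
    exact lieDeriv_mem_B2 (𝔤.B2_le_Z2 ih) ht

theorem isRigid_of_Z2_le_B2 {𝔤 : LieSuperalgebra K V} (h : 𝔤.Z2 ≤ 𝔤.B2) : 𝔤.IsRigid := by
  unfold IsRigid H2
  rw [Submodule.Quotient.subsingleton_iff]
  exact Submodule.submoduleOf_eq_top.2 h

end LieSuperalgebra

/-! ### Torus weights and reduction to weight zero -/

namespace SLSpace

variable (K : Type*) [Field K] (n m : ℕ)

/-- The basis vector with index `a`. -/
abbrev e (a : SLIndex n m) : SLSpace K n m := Pi.single a 1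

/-- The weight of a basis vector with respect to `(T₁, T₂, T₃)`. -/
def weight : SLIndex n m → Fin 3 → K
  | .inl i => ![(i : K) + 1, if 1 ≤ (i : ℕ) then 1 else 0, 0]
  | .inr (.inl _) => 0
  | .inr (.inr j) => ![(j : K) + 1, 0, 1]

variable {K n m}

theorem bracket_T_single (l : Fin 3) (a : SLIndex n m) :
    bracket K n m (e K n m (.inr (.inl l))) (e K n m a) = weight K n m a l • e K n m a := by
  rw [bracket_single]
  rcases a with i | s | j
  · fin_cases l <;> simp [listed, weight, X_succ]
  · simp [listed, weight]
  · fin_cases l <;> simp [listed, weight, Y_succ]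

theorem ext_basis {M : Type*} [AddCommGroup M] [Module K M] {f g : SLSpace K n m →ₗ[K] M}
    (h : ∀ a, f (e K n m a) = g (e K n m a)) : f = g :=
  (Pi.basisFun K _).ext fun a => by simpa [Pi.basisFun_apply] using h a

theorem bracket_T_apply (l : Fin 3) (v : SLSpace K n m) (k : SLIndex n m) :
    bracket K n m (e K n m (.inr (.inl l))) v k = weight K n m k l * v k := by
  have : LinearMap.proj k ∘ₗ bracket K n m (e K n m (.inr (.inl l))) =
      weight K n m k l • LinearMap.proj (R := K) (φ := fun _ : SLIndex n m => K) k := by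
    refine ext_basis fun a => ?_
    by_cases h : k = a <;> simp [bracket_T_single, h]
  exact congrArg (fun f => f v) this

theorem single_inl_mem_even (i : Fin n) : e K n m (.inl i) ∈ (SL K n m).even :=
  ⟨fun _ j => by simp, fun h => absurd h (by decide)⟩

theorem single_T_mem_even (l : Fin 3) : e K n m (.inr (.inl l)) ∈ (SL K n m).even :=
  ⟨fun _ j => by simp, fun h => absurd h (by decide)⟩

theorem single_Y_mem_odd (j : Fin m) : e K n m (.inr (.inr j)) ∈ (SL K n m).odd :=
  ⟨fun h => absurd h (by decide), fun _ => ⟨fun i => by simp, fun l => by simp⟩⟩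

theorem SL_bracket : (SL K n m).bracket = bracket K n m := rfl

theorem lieDeriv_single (l : Fin 3) (c : SLSpace K n m →ₗ[K] SLSpace K n m →ₗ[K] SLSpace K n m)
    (a b k : SLIndex n m) :
    (SL K n m).lieDeriv (e K n m (.inr (.inl l))) c (e K n m a) (e K n m b) k =
      (weight K n m k l - weight K n m a l - weight K n m b l) * c (e K n m a) (e K n m b) k := by
  rw [LieSuperalgebra.lieDeriv_apply, SL_bracket, bracket_T_single, bracket_T_single]
  simp [bracket_T_apply]
  ring

theorem lieDeriv_iterate_single (l : Fin 3)
    (c : SLSpace K n m →ₗ[K] SLSpace K n m →ₗ[K] SLSpace K n m) (a b k : SLIndex n m) (q : ℕ) :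
    ((SL K n m).lieDeriv (e K n m (.inr (.inl l))))^[q] c (e K n m a) (e K n m b) k =
      (weight K n m k l - weight K n m a l - weight K n m b l) ^ q *
        c (e K n m a) (e K n m b) k := by
  induction q with
  | zero => simp
  | succ q ih => rw [Function.iterate_succ_apply', lieDeriv_single, ih]; ring

/-- The weights are images of integers, hence fixed by Frobenius. -/
theorem weight_pow (p : ℕ) [CharP K p] [Fact p.Prime] (a : SLIndex n m) (l : Fin 3) :
    weight K n m a l ^ p = weight K n m a l := by
  have hp := (Fact.out : p.Prime).ne_zero
  have h (i : ℕ) : ((i : K) + 1) ^ p = i + 1 := by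
    rw [add_pow_char, one_pow, ← frobenius_def, map_natCast]
  rcases a with i | s | j
  · fin_cases l <;> simp [weight, h, hp]
  · simp [weight, hp]
  · fin_cases l <;> simp [weight, h, hp]

/-- A cochain is of weight zero if it commutes with the torus. -/
def IsWeightZero (c : SLSpace K n m →ₗ[K] SLSpace K n m →ₗ[K] SLSpace K n m) : Prop :=
  ∀ a b k, c (e K n m a) (e K n m b) k ≠ 0 →
    ∀ l, weight K n m k l = weight K n m a l + weight K n m b l

/-- The new cocycle is `c - L ^ (p - 1) c`, with `L` the Lie derivative along `T_l`. That its
support lies in the support of `c` is recorded so that later projections, for other `T_l`, do not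
undo earlier ones. -/
theorem exists_weight_zero_at (p : ℕ) [CharP K p] [Fact p.Prime]
    {c : SLSpace K n m →ₗ[K] SLSpace K n m →ₗ[K] SLSpace K n m} (hc : c ∈ (SL K n m).Z2)
    (l : Fin 3) : ∃ c' ∈ (SL K n m).Z2, c - c' ∈ (SL K n m).B2 ∧
      ∀ a b k, c' (e K n m a) (e K n m b) k ≠ 0 → c (e K n m a) (e K n m b) k ≠ 0 ∧
        weight K n m k l = weight K n m a l + weight K n m b l := by
  have hp1 := (Fact.out : p.Prime).two_le
  -- Thus `p - 1 = q + 1` is a positive number of iterations, as needed for the result to be a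
  -- coboundary.
  obtain ⟨q, rfl⟩ : ∃ q, p = q + 1 + 1 := ⟨p - 2, by omega⟩
  have hB := LieSuperalgebra.lieDeriv_iterate_mem_B2 hc (single_T_mem_even l) q
  refine ⟨_, sub_mem hc ((SL K n m).B2_le_Z2 hB), ?_, fun a b k h => ?_⟩
  · rwa [sub_sub_cancel]
  · rw [LinearMap.sub_apply, LinearMap.sub_apply, Pi.sub_apply, lieDeriv_iterate_single] at h
    set w := weight K n m k l - weight K n m a l - weight K n m b l with hw
    -- By additivity of the `p`-th power, `w` satisfies `w ^ p = w`, so `w ^ (p - 1) = 1` unless `w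
    -- = 0`.
    have hwp : w ^ (q + 1 + 1) = w := by
      rw [hw, sub_pow_char, sub_pow_char, weight_pow, weight_pow, weight_pow]
    refine ⟨fun h0 => h (by rw [h0]; ring), ?_⟩
    by_contra hne
    have hw0 : w ≠ 0 := fun h0 => hne (by linear_combination h0)
    have : w ^ (q + 1) = 1 := mul_right_cancel₀ hw0 (by rw [← pow_succ, hwp, one_mul])
    exact h (by rw [this]; ring)

theorem exists_weight_zero (p : ℕ) [CharP K p] [Fact p.Prime]
    {c : SLSpace K n m →ₗ[K] SLSpace K n m →ₗ[K] SLSpace K n m} (hc : c ∈ (SL K n m).Z2) :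
    ∃ c' ∈ (SL K n m).Z2, c - c' ∈ (SL K n m).B2 ∧ IsWeightZero c' := by
  obtain ⟨c₀, z₀, b₀, w₀⟩ := exists_weight_zero_at p hc 0
  obtain ⟨c₁, z₁, b₁, w₁⟩ := exists_weight_zero_at p z₀ 1
  obtain ⟨c₂, z₂, b₂, w₂⟩ := exists_weight_zero_at p z₁ 2
  refine ⟨c₂, z₂, ?_, fun a b k h l => ?_⟩
  · have : c - c₂ = (c - c₀) + (c₀ - c₁) + (c₁ - c₂) := by abel
    rw [this]
    exact add_mem (add_mem b₀ b₁) b₂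
  · have h₂ := w₂ a b k h
    have h₁ := w₁ a b k h₂.1
    have h₀ := w₀ a b k h₁.1
    fin_cases l
    · exact h₀.2
    · exact h₁.2
    · exact h₂.2

end SLSpace
-- Weight spaces, first constraints on cochains, and signless coboundaries
namespace SLSpace

variable {K : Type*} [Field K] {n m : ℕ}

theorem natCast_inj_of_lt (p : ℕ) [CharP K p] {a b : ℕ} (h : (a : K) = b) (ha : a < p)
    (hb : b < p) : a = b :=
  CharP.natCast_injOn_Iio K p ha hb h

theorem natCast_ne_of_lt (p : ℕ) [CharP K p] {a b : ℕ} (hab : a < b) (hb : b < p + a) :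
    (a : K) ≠ b := by
  intro h
  have h0 : ((b - a : ℕ) : K) = 0 := by rw [Nat.cast_sub hab.le, h, sub_self]
  have := Nat.le_of_dvd (by omega) ((CharP.cast_eq_zero_iff K p _).1 h0)
  omega

/-- `T₃` separates the `Y_j` from everything else, `T₁` separates vectors within each family, and
`T₁` or `T₂` separates an `X_i` from the torus. For `n = p` the vector `X_p` has `T₁`-weight zero,
and only `T₂` tells it from the torus. -/
theorem weight_injective (p : ℕ) [CharP K p] (hn : n < p + 1) (hm : m < p)
    {a b : SLIndex n m} (h : ∀ l, weight K n m a l = weight K n m b l)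
    (ha : ∀ l, a ≠ .inr (.inl l)) : a = b := by
  have h0 := h 0
  have h1 := h 1
  have h2 := h 2
  rcases a with i | s | j
  · rcases b with i' | s' | j'
    · simp only [weight, Matrix.cons_val_zero, add_left_inj] at h0
      rw [Fin.ext (natCast_inj_of_lt p h0 (by omega) (by omega))]
    · by_cases hi : 1 ≤ (i : ℕ)
      · simp [weight, hi] at h1
      · simp [weight, show (i : ℕ) = 0 by omega] at h0
    · simp [weight] at h2
  · exact absurd rfl (ha s)
  · rcases b with i' | s' | j'
    · simp [weight] at h2
    · simp [weight] at h2
    · simp only [weight, Matrix.cons_val_zero, add_left_inj] at h0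
      rw [Fin.ext (natCast_inj_of_lt p h0 (by omega) (by omega))]

variable {c : SLSpace K n m →ₗ[K] SLSpace K n m →ₗ[K] SLSpace K n m}

/-- Outside the torus the weight spaces are lines, so a weight-zero value of that weight has a
single possible coordinate. -/
theorem IsWeightZero.eq_smul_of_weight (p : ℕ) [CharP K p] (hn : n < p + 1) (hm : m < p)
    (hw : IsWeightZero c) {a b d : SLIndex n m}
    (h : ∀ l, weight K n m d l = weight K n m a l + weight K n m b l)
    (hd : ∀ l, d ≠ .inr (.inl l)) :
    c (e K n m a) (e K n m b) = c (e K n m a) (e K n m b) d • e K n m d := by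
  funext k
  by_cases hk : k = d
  · subst hk; simp
  · have : c (e K n m a) (e K n m b) k = 0 := by
      by_contra h0
      exact hk (weight_injective p hn hm (fun l => by rw [h l, hw a b k h0 l]) hd).symm
    simp [this, hk]

theorem IsWeightZero.eq_zero_of_weight (hw : IsWeightZero c) {a b : SLIndex n m}
    (h : ∀ k, ∃ l, weight K n m k l ≠ weight K n m a l + weight K n m b l) :
    c (e K n m a) (e K n m b) = 0 := by
  funext k
  by_contra h0
  obtain ⟨l, hl⟩ := h k
  exact hl (hw a b k h0 l)

/-- Two vectors among `X₂, …, Xₙ, Y₁, …, Yₘ` are annihilated by a weight-zero cochain. -/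
theorem IsWeightZero.apply_nilradical (h2 : (2 : K) ≠ 0) (hw : IsWeightZero c)
    {a b : SLIndex n m} (ha : weight K n m a 1 = 1 ∨ weight K n m a 2 = 1)
    (hb : weight K n m b 1 = 1 ∨ weight K n m b 2 = 1) :
    c (e K n m a) (e K n m b) = 0 := by
  have h1 : (1 : K) + 1 ≠ 0 := by rwa [one_add_one_eq_two]
  have key (a : SLIndex n m) : (weight K n m a 1 = 0 ∨ weight K n m a 1 = 1) ∧
      (weight K n m a 2 = 0 ∨ weight K n m a 2 = 1) ∧
      ¬(weight K n m a 1 = 1 ∧ weight K n m a 2 = 1) := by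
    rcases a with i | s | j
    · by_cases hi : 1 ≤ (i : ℕ) <;> simp [weight, hi]
    · simp [weight]
    · simp [weight]
  -- Every basis vector has `(T₂, T₃)`-weight `(0, 0)`, `(1, 0)` or `(0, 1)`. The two arguments have
  -- nonzero pairs, with sum `(2, 0)`, `(1, 1)` or `(0, 2)`, which never recurs because `2` is
  -- neither `0` nor `1`.
  refine hw.eq_zero_of_weight fun k => ?_
  by_contra! H
  have H1 := (H 1).symm
  have H2 := (H 2).symm
  obtain ⟨a1, a2, a3⟩ := key a
  obtain ⟨b1, b2, b3⟩ := key b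
  obtain ⟨k1, k2, k3⟩ := key k
  clear key H hw
  rcases a1 with a1 | a1 <;> rcases a2 with a2 | a2 <;> rcases b1 with b1 | b1 <;>
    rcases b2 with b2 | b2 <;> rcases k1 with k1 | k1 <;> rcases k2 with k2 | k2 <;>
    simp [a1, a2, b1, b2, k1, k2, h1] at ha hb H1 H2 a3 b3 k3

theorem cochain_skew_single (hc : c ∈ (SL K n m).C2) {a b : SLIndex n m}
    (h : (∀ j, a ≠ .inr (.inr j)) ∨ ∀ j, b ≠ .inr (.inr j)) :
    c (e K n m a) (e K n m b) = -c (e K n m b) (e K n m a) := by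
  have par (a : SLIndex n m) : e K n m a ∈ (SL K n m).even ∨
      (e K n m a ∈ (SL K n m).odd ∧ ∃ j, a = .inr (.inr j)) := by
    rcases a with i | s | j
    · exact .inl (single_inl_mem_even i)
    · exact .inl (single_T_mem_even s)
    · exact .inr ⟨single_Y_mem_odd j, j, rfl⟩
  rcases par a with ha | ⟨ha, j, rfl⟩ <;> rcases par b with hb | ⟨hb, j', rfl⟩
  · exact LieSuperalgebra.C2_even_skew hc ha hb
  · rw [hc.2.1 _ ha _ hb, neg_neg]
  · exact hc.2.1 _ hb _ ha
  · rcases h with h | h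
    · exact absurd rfl (h _)
    · exact absurd rfl (h _)

/-- In the cocycle identity on `(T_s, T_t, a)` the terms with `c(T_s, a)` and `c(T_t, a)` cancel,
because both maps are diagonal at `a` and so commute with the torus action. -/
theorem cocycle_T_T_single (hc : c ∈ (SL K n m).Z2) (s t : Fin 3) (a : SLIndex n m)
    (hs : c (e K n m (.inr (.inl s))) (e K n m a) =
      c (e K n m (.inr (.inl s))) (e K n m a) a • e K n m a)
    (ht : c (e K n m (.inr (.inl t))) (e K n m a) =
      c (e K n m (.inr (.inl t))) (e K n m a) a • e K n m a) :
    bracket K n m (e K n m a) (c (e K n m (.inr (.inl s))) (e K n m (.inr (.inl t)))) = 0 := by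
  have hTT : bracket K n m (e K n m (.inr (.inl s))) (e K n m (.inr (.inl t))) = 0 := by
    rw [bracket_T_single]; simp [weight]
  obtain ⟨hC, z1, z2, -, -⟩ := hc
  rw [SL_bracket] at z1 z2
  generalize c (e K n m (.inr (.inl s))) (e K n m a) a = x at hs
  generalize c (e K n m (.inr (.inl t))) (e K n m a) a = y at ht
  by_cases ha : ∃ j, a = .inr (.inr j)
  · obtain ⟨j, rfl⟩ := ha
    have h := z2 _ (single_T_mem_even s) _ (single_T_mem_even t) _ (single_Y_mem_odd j)
    simp only [hTT, hs, ht, bracket_T_single, map_smul, map_zero, LinearMap.zero_apply] at h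
    linear_combination (norm := module) -h
  · have ha' : e K n m a ∈ (SL K n m).even := by
      rcases a with i | r | j
      · exact single_inl_mem_even i
      · exact single_T_mem_even r
      · exact absurd ⟨j, rfl⟩ ha
    have h := z1 _ (single_T_mem_even s) _ (single_T_mem_even t) _ ha'
    have hs' := hs
    have ht' := ht
    rw [cochain_skew_single hC (.inl (by simp))] at hs' ht'
    rw [neg_eq_iff_eq_neg] at hs' ht'
    simp only [hTT, hs, ht, hs', ht', bracket_T_single, map_smul, map_zero, LinearMap.zero_apply,
      LinearMap.smul_apply] at h
    linear_combination (norm := module) -h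

/-- The coboundary of a linear map, without signs. -/
noncomputable def cobd (f : SLSpace K n m →ₗ[K] SLSpace K n m) :
    SLSpace K n m →ₗ[K] SLSpace K n m →ₗ[K] SLSpace K n m :=
  (bracket K n m).compr₂ f - (bracket K n m).compl₂ f + ((bracket K n m).compl₂ f).flip

theorem cobd_apply (f : SLSpace K n m →ₗ[K] SLSpace K n m) (x y : SLSpace K n m) :
    cobd f x y = f (bracket K n m x y) - bracket K n m x (f y) + bracket K n m y (f x) := rfl

theorem cobd_skew (f : SLSpace K n m →ₗ[K] SLSpace K n m) (x y : SLSpace K n m) :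
    cobd f x y = -cobd f y x := by
  rw [cobd_apply, cobd_apply, bracket_comm K n m x y, map_neg]
  abel

/-- The signless formula differs from the true differential only on two odd arguments, in the sign
of a bracket of odd vectors, and such brackets vanish here. -/
theorem mem_B2_of_eq_cobd (hc : c ∈ (SL K n m).C2) (f : SLSpace K n m →ₗ[K] SLSpace K n m)
    (hf : ∀ x ∈ (SL K n m).odd, f x ∈ (SL K n m).odd) (h : c = cobd f) :
    c ∈ (SL K n m).B2 := by
  refine ⟨hc, f, fun x _ y _ => ?_, fun x _ y _ => ?_, fun x hx y hy => ?_⟩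
  · rw [h]; rfl
  · rw [h]; rfl
  · rw [h, cobd_apply, SL_bracket, bracket_odd_odd K n m y hy _ (hf x hx)]
    abel

theorem bracket_X_zero_X (hn : 0 < n) (i : Fin n) :
    bracket K n m (e K n m (.inl ⟨0, hn⟩)) (e K n m (.inl i)) =
      if 1 ≤ (i : ℕ) then X K n m (i + 2) else 0 := by
  rw [bracket_single]
  simp [listed]

theorem bracket_X_zero_Y (hn : 0 < n) (j : Fin m) :
    bracket K n m (e K n m (.inl ⟨0, hn⟩)) (e K n m (.inr (.inr j))) = Y K n m (j + 2) := by
  rw [bracket_single]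
  simp [listed]

theorem X_eq_zero {i : ℕ} (h : n < i) : X K n m i = 0 := by
  rcases X_cases K n m i with h' | ⟨k, hk⟩
  · exact h'
  · omega

theorem Y_eq_zero {j : ℕ} (h : m < j) : Y K n m j = 0 := by
  rcases Y_cases K n m j with h' | ⟨k, hk⟩
  · exact h'
  · omega

/-- The linear map of weight zero which is diagonal on the `X` and `Y` vectors. -/
noncomputable def diagMap (t : Fin 3 → Fin 3 → K) (x y : ℕ → K) :
    SLSpace K n m →ₗ[K] SLSpace K n m :=
  (Pi.basisFun K (SLIndex n m)).constr K fun
    | .inl i => x i • e K n m (.inl i)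
    | .inr (.inl l) => ∑ r, t l r • e K n m (.inr (.inl r))
    | .inr (.inr j) => y j • e K n m (.inr (.inr j))

/-! ### Diagonal maps -/

section diagMap

variable (t : Fin 3 → Fin 3 → K) (x y : ℕ → K)

theorem diagMap_X_single (i : Fin n) :
    diagMap (n := n) (m := m) t x y (e K n m (.inl i)) = x i • e K n m (.inl i) := by
  rw [e, ← Pi.basisFun_apply, diagMap, Module.Basis.constr_basis, Pi.basisFun_apply]

theorem diagMap_T_single (l : Fin 3) :
    diagMap (n := n) (m := m) t x y (e K n m (.inr (.inl l))) =
      ∑ r, t l r • e K n m (.inr (.inl r)) := by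
  rw [e, ← Pi.basisFun_apply, diagMap, Module.Basis.constr_basis]

theorem diagMap_Y_single (j : Fin m) :
    diagMap (n := n) (m := m) t x y (e K n m (.inr (.inr j))) = y j • e K n m (.inr (.inr j)) := by
  rw [e, ← Pi.basisFun_apply, diagMap, Module.Basis.constr_basis, Pi.basisFun_apply]

theorem diagMap_X (i : ℕ) :
    diagMap (n := n) (m := m) t x y (X K n m (i + 1)) = x i • X K n m (i + 1) := by
  -- The scalar `x i` belongs to `X_{i+1}`; past the end of the basis both sides are zero.
  by_cases h : i < n
  · have := diagMap_X_single (m := m) t x y ⟨i, h⟩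
    rwa [e, ← X_succ] at this
  · rw [X_eq_zero (by omega)]; simp

theorem diagMap_Y (j : ℕ) :
    diagMap (n := n) (m := m) t x y (Y K n m (j + 1)) = y j • Y K n m (j + 1) := by
  by_cases h : j < m
  · have := diagMap_Y_single (n := n) t x y ⟨j, h⟩
    rwa [e, ← Y_succ] at this
  · rw [Y_eq_zero (by omega)]; simp

theorem bracket_single_sum_T (a : SLIndex n m) (u : Fin 3 → K) :
    bracket K n m (e K n m a) (∑ r, u r • e K n m (.inr (.inl r))) =
      -((∑ r, u r * weight K n m a r) • e K n m a) := by
  rw [bracket_comm, map_sum, LinearMap.sum_apply, Finset.sum_smul]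
  simp only [map_smul, LinearMap.smul_apply, bracket_T_single, smul_smul]

theorem diagMap_odd (v : SLSpace K n m) (hv : v ∈ (SL K n m).odd) :
    diagMap t x y v ∈ (SL K n m).odd := by
  obtain ⟨h1, h2⟩ := hv.2 rfl
  have : v = ∑ a, v a • e K n m a := by
    conv_lhs => rw [← (Pi.basisFun K (SLIndex n m)).sum_repr v]
    simp
  rw [this, map_sum]
  refine sum_mem fun a _ => ?_
  rcases a with i | l | j
  · simp [h1]
  · simp [h2]
  · rw [map_smul, diagMap_Y_single]
    exact Submodule.smul_mem _ _ (Submodule.smul_mem _ _ (single_Y_mem_odd j))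

end diagMap

end SLSpace
-- Values of a weight-zero cocycle on pairs of basis vectors
namespace SLSpace

variable {K : Type*} [Field K] {n m : ℕ}
  {c : SLSpace K n m →ₗ[K] SLSpace K n m →ₗ[K] SLSpace K n m}

section WeightZero

variable (p : ℕ) [CharP K p]

theorem IsWeightZero.apply_T_single (hn : n < p + 1) (hm : m < p) (hw : IsWeightZero c) (l : Fin 3)
    {a : SLIndex n m} (ha : ∀ l, a ≠ .inr (.inl l)) :
    c (e K n m (.inr (.inl l))) (e K n m a) =
      c (e K n m (.inr (.inl l))) (e K n m a) a • e K n m a :=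
  hw.eq_smul_of_weight p hn hm (fun l => by simp [weight]) ha

/-- The value has weight zero, so it lies in the torus, and by the cocycle identity it commutes with
`X₁`, `X₂`, `Y₁`. Their weights `(1, 0, 0)`, `(2, 1, 0)`, `(1, 0, 1)` are linearly independent. -/
theorem IsWeightZero.apply_T_T (hn : n < p + 1) (hn1 : 1 < n) (hm : m < p) (hm1 : 0 < m)
    (hc : c ∈ (SL K n m).Z2) (hw : IsWeightZero c) (s t : Fin 3) :
    c (e K n m (.inr (.inl s))) (e K n m (.inr (.inl t))) = 0 := by
  set v := c (e K n m (.inr (.inl s))) (e K n m (.inr (.inl t))) with hv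
  have hX (i : Fin n) : v (.inl i) = 0 := by
    by_contra h
    have := weight_injective (K := K) p hn hm (a := .inl i) (b := .inr (.inl (0 : Fin 3)))
      (fun l => by simpa [weight] using hw _ _ _ h l) (by simp)
    simp at this
  have hY (j : Fin m) : v (.inr (.inr j)) = 0 := by
    by_contra h
    have := weight_injective (K := K) p hn hm (a := .inr (.inr j)) (b := .inr (.inl (0 : Fin 3)))
      (fun l => by simpa [weight] using hw _ _ _ h l) (by simp)
    simp at this
  have hvT : v = ∑ r, v (.inr (.inl r)) • e K n m (.inr (.inl r)) := by
    funext k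
    rcases k with i | r | j
    · simp [hX]
    · simp [Finset.sum_apply, Pi.single_apply]
    · simp [hY]
  have key {a : SLIndex n m} (ha : ∀ l, a ≠ .inr (.inl l)) :
      ∑ r, v (.inr (.inl r)) * weight K n m a r = 0 := by
    have h := cocycle_T_T_single hc s t a (hw.apply_T_single p hn hm s ha)
      (hw.apply_T_single p hn hm t ha)
    rw [← hv, hvT, bracket_single_sum_T, neg_eq_zero] at h
    simpa using congrFun h a
  have h1 := key (a := .inl ⟨0, by omega⟩) (by simp)
  have h2 := key (a := .inl ⟨1, hn1⟩) (by simp)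
  have h3 := key (a := .inr (.inr ⟨0, hm1⟩)) (by simp)
  simp [Fin.sum_univ_three, weight] at h1 h2 h3
  simp only [h1, zero_mul, zero_add] at h2 h3
  rw [hvT, Fin.sum_univ_three, h1, h2, h3]
  simp

theorem IsWeightZero.apply_X_X (hn : n < p + 1) (hm : m < p) (hw : IsWeightZero c) (h0 : 0 < n)
    {i : ℕ} (hi : 1 ≤ i) (h : i + 1 < n) :
    c (e K n m (.inl ⟨0, h0⟩)) (e K n m (.inl ⟨i, by omega⟩)) =
      c (e K n m (.inl ⟨0, h0⟩)) (e K n m (.inl ⟨i, by omega⟩)) (.inl ⟨i + 1, h⟩) •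
        e K n m (.inl ⟨i + 1, h⟩) := by
  refine hw.eq_smul_of_weight p hn hm (fun l => ?_) (by simp)
  fin_cases l <;> simp [weight, hi]
  ring

/-- A nonzero coordinate would sit at some `X_k` with `2 ≤ k ≤ n` and `k ≡ n + 1` modulo `p`,
impossible for `n ≤ p`. When `n = p`, `T₁` alone would allow `X₁`, which `T₂` excludes. -/
theorem IsWeightZero.apply_X_X_last (hn : n < p + 1) (hw : IsWeightZero c) (h0 : 0 < n)
    {i : ℕ} (hi : 1 ≤ i) (h : i + 1 = n) :
    c (e K n m (.inl ⟨0, h0⟩)) (e K n m (.inl ⟨i, by omega⟩)) = 0 := by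
  refine hw.eq_zero_of_weight fun k => ?_
  by_contra! H
  have H0 := H 0
  have H1 := H 1
  have H2 := H 2
  rcases k with k | k | k
  · by_cases hk : 1 ≤ (k : ℕ)
    · refine natCast_ne_of_lt (K := K) p k.2 (by omega) ?_
      simp only [weight, Matrix.cons_val_zero] at H0
      push_cast [← h] at H0 ⊢
      linear_combination H0
    · simp [weight, hi, hk] at H1
  · simp [weight, hi] at H1
  · simp [weight] at H2

theorem IsWeightZero.apply_X_Y (hn : n < p + 1) (hm : m < p) (hw : IsWeightZero c) (h0 : 0 < n)
    {j : ℕ} (h : j + 1 < m) :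
    c (e K n m (.inl ⟨0, h0⟩)) (e K n m (.inr (.inr ⟨j, by omega⟩))) =
      c (e K n m (.inl ⟨0, h0⟩)) (e K n m (.inr (.inr ⟨j, by omega⟩))) (.inr (.inr ⟨j + 1, h⟩)) •
        e K n m (.inr (.inr ⟨j + 1, h⟩)) := by
  refine hw.eq_smul_of_weight p hn hm (fun l => ?_) (by simp)
  fin_cases l <;> simp [weight]
  ring

/-- Here `m < p` is essential: for `m = p` the value would have the weight of `Y₁`. -/
theorem IsWeightZero.apply_X_Y_last (hm : m < p) (hw : IsWeightZero c) (h0 : 0 < n)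
    {j : ℕ} (h : j + 1 = m) :
    c (e K n m (.inl ⟨0, h0⟩)) (e K n m (.inr (.inr ⟨j, by omega⟩))) = 0 := by
  refine hw.eq_zero_of_weight fun k => ?_
  by_contra! H
  have H0 := H 0
  have H2 := H 2
  rcases k with k | k | k
  · simp [weight] at H2
  · simp [weight] at H2
  · refine natCast_ne_of_lt (K := K) p k.2 (by omega) ?_
    simp only [weight, Matrix.cons_val_zero] at H0
    push_cast [← h] at H0 ⊢
    linear_combination H0

end WeightZero
end SLSpace
-- The torus components `c(T_l, ·)`
namespace SLSpace

variable {K : Type*} [Field K] {n m : ℕ}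
  {c : SLSpace K n m →ₗ[K] SLSpace K n m →ₗ[K] SLSpace K n m}

/-- The eigenvalues of `c(T_l, ·)` add along brackets, as for a derivation. In the `d`-coordinate of
the cocycle identity on `(T_l, a, b)`, the terms with `c(a, b)` cancel because the weights add. -/
theorem cocycle_T_single_single (hc : c ∈ (SL K n m).Z2) (l : Fin 3) {a b d : SLIndex n m}
    (ha : ∀ j, a ≠ .inr (.inr j))
    (hd : bracket K n m (e K n m a) (e K n m b) = e K n m d)
    (hw : weight K n m d l = weight K n m a l + weight K n m b l)
    (h : ∀ r ∈ ({a, b, d} : Set (SLIndex n m)), c (e K n m (.inr (.inl l))) (e K n m r) =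
      c (e K n m (.inr (.inl l))) (e K n m r) r • e K n m r) :
    c (e K n m (.inr (.inl l))) (e K n m d) d =
      c (e K n m (.inr (.inl l))) (e K n m a) a + c (e K n m (.inr (.inl l))) (e K n m b) b := by
  have h1 := h a (by simp)
  have h2 := h b (by simp)
  generalize c (e K n m (.inr (.inl l))) (e K n m a) a = x at *
  generalize c (e K n m (.inr (.inl l))) (e K n m b) b = y at *
  have ha' : e K n m a ∈ (SL K n m).even := by
    rcases a with i | r | j
    · exact single_inl_mem_even i
    · exact single_T_mem_even r
    · exact absurd rfl (ha j)
  have hba : bracket K n m (e K n m b) (e K n m a) = -e K n m d := by rw [bracket_comm, hd]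
  obtain ⟨hC, z1, z2, -, -⟩ := hc
  rw [SL_bracket] at z1 z2
  by_cases hb : ∃ j, b = .inr (.inr j)
  · obtain ⟨j, rfl⟩ := hb
    have z := congrFun (z2 _ (single_T_mem_even l) _ ha' _ (single_Y_mem_odd j)) d
    simp only [bracket_T_single, hd, hba, h1, h2, map_smul, LinearMap.smul_apply, Pi.add_apply,
      Pi.sub_apply, Pi.smul_apply, bracket_T_apply, smul_eq_mul, Pi.neg_apply, Pi.zero_apply,
      Pi.single_eq_same, hw] at z
    linear_combination -z
  · have hb' : e K n m b ∈ (SL K n m).even := by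
      rcases b with i | r | j
      · exact single_inl_mem_even i
      · exact single_T_mem_even r
      · exact absurd ⟨j, rfl⟩ hb
    have z := congrFun (z1 _ (single_T_mem_even l) _ ha' _ hb') d
    have s1 : c (e K n m b) (e K n m a) = -c (e K n m a) (e K n m b) :=
      LieSuperalgebra.C2_even_skew hC hb' ha'
    have s2 : c (e K n m d) (e K n m (.inr (.inl l))) = -c (e K n m (.inr (.inl l))) (e K n m d) :=
      cochain_skew_single hC (.inr (by simp))
    simp only [bracket_T_single, hd, hba, h1, h2, map_smul, LinearMap.smul_apply, Pi.add_apply,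
      Pi.sub_apply, Pi.smul_apply, bracket_T_apply, smul_eq_mul, Pi.neg_apply, Pi.zero_apply,
      Pi.single_eq_same, hw, s1, s2] at z
    linear_combination -z

section Torus

variable (p : ℕ) [CharP K p]

/-- Each bracket with `X₁` adds the eigenvalue at `X₁`, so from `X₂` on the eigenvalues form an
arithmetic progression. -/
theorem IsWeightZero.coeff_X (hn : n < p + 1) (hm : m < p) (hn1 : 1 < n)
    (hc : c ∈ (SL K n m).Z2) (hw : IsWeightZero c) (l : Fin 3) (i : ℕ) (hi : i + 1 < n) :
    c (e K n m (.inr (.inl l))) (e K n m (.inl ⟨i + 1, hi⟩)) (.inl ⟨i + 1, hi⟩) =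
      c (e K n m (.inr (.inl l))) (e K n m (.inl ⟨1, hn1⟩)) (.inl ⟨1, hn1⟩) +
        i * c (e K n m (.inr (.inl l))) (e K n m (.inl ⟨0, by omega⟩)) (.inl ⟨0, by omega⟩) := by
  induction i with
  | zero => simp
  | succ i ih =>
    have h := cocycle_T_single_single hc l (a := .inl ⟨0, by omega⟩)
      (b := .inl ⟨i + 1, by omega⟩) (d := .inl ⟨i + 1 + 1, hi⟩) (by simp)
      (by rw [bracket_X_zero_X, if_pos (by simp)]; exact X_succ K n m ⟨i + 1 + 1, hi⟩)
      (by fin_cases l <;> simp [weight]; ring)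
      (fun r hr => hw.apply_T_single p hn hm l (by rcases hr with rfl | rfl | rfl <;> simp))
    rw [h, ih (by omega)]
    push_cast
    ring

theorem IsWeightZero.coeff_Y (hn : n < p + 1) (hm : m < p) (hn0 : 0 < n) (hm0 : 0 < m)
    (hc : c ∈ (SL K n m).Z2) (hw : IsWeightZero c) (l : Fin 3) (j : ℕ) (hj : j < m) :
    c (e K n m (.inr (.inl l))) (e K n m (.inr (.inr ⟨j, hj⟩))) (.inr (.inr ⟨j, hj⟩)) =
      c (e K n m (.inr (.inl l))) (e K n m (.inr (.inr ⟨0, hm0⟩))) (.inr (.inr ⟨0, hm0⟩)) +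
        j * c (e K n m (.inr (.inl l))) (e K n m (.inl ⟨0, hn0⟩)) (.inl ⟨0, hn0⟩) := by
  induction j with
  | zero => simp
  | succ j ih =>
    have h := cocycle_T_single_single hc l (a := .inl ⟨0, hn0⟩)
      (b := .inr (.inr ⟨j, by omega⟩)) (d := .inr (.inr ⟨j + 1, hj⟩)) (by simp)
      (by rw [bracket_X_zero_Y]; exact Y_succ K n m ⟨j + 1, hj⟩)
      (by fin_cases l <;> simp [weight]; ring)
      (fun r hr => hw.apply_T_single p hn hm l (by rcases hr with rfl | rfl | rfl <;> simp))
    rw [h, ih (by omega)]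
    push_cast
    ring

/-- The torus element by which the components `c(T_l, ·)` are killed. -/
theorem IsWeightZero.exists_torus (hn : n < p + 1) (hm : m < p) (hn1 : 1 < n) (hm0 : 0 < m)
    (hc : c ∈ (SL K n m).Z2) (hw : IsWeightZero c) (l : Fin 3) :
    ∃ u : Fin 3 → K, ∀ a : SLIndex n m, (∀ l, a ≠ .inr (.inl l)) →
      ∑ r, u r * weight K n m a r = -c (e K n m (.inr (.inl l))) (e K n m a) a := by
  -- The unique solution of the equations at `X₁`, `X₂`, `Y₁`; the others follow since both sides
  -- are arithmetic progressions along the chains of `X₁`.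
  refine ⟨![-c (e K n m (.inr (.inl l))) (e K n m (.inl ⟨0, by omega⟩)) (.inl ⟨0, by omega⟩),
    2 * c (e K n m (.inr (.inl l))) (e K n m (.inl ⟨0, by omega⟩)) (.inl ⟨0, by omega⟩) -
      c (e K n m (.inr (.inl l))) (e K n m (.inl ⟨1, hn1⟩)) (.inl ⟨1, hn1⟩),
    c (e K n m (.inr (.inl l))) (e K n m (.inl ⟨0, by omega⟩)) (.inl ⟨0, by omega⟩) -
      c (e K n m (.inr (.inl l))) (e K n m (.inr (.inr ⟨0, hm0⟩))) (.inr (.inr ⟨0, hm0⟩))],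
    fun a ha => ?_⟩
  rcases a with ⟨i, hi⟩ | r | ⟨j, hj⟩
  · rcases i with _ | i
    · simp [Fin.sum_univ_three, weight]
    · rw [hw.coeff_X p hn hm hn1 hc l i hi]
      simp [Fin.sum_univ_three, weight]
      ring
  · exact absurd rfl (ha r)
  · rw [hw.coeff_Y p hn hm (by omega) hm0 hc l j hj]
    simp [Fin.sum_univ_three, weight]
    ring

end Torus

/-! ### Coboundaries of diagonal maps and the primitive -/

section Diag

variable (t : Fin 3 → Fin 3 → K) (x y : ℕ → K)

theorem cobd_diagMap_T_T (r s : Fin 3) :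
    cobd (diagMap (n := n) (m := m) t x y) (e K n m (.inr (.inl r))) (e K n m (.inr (.inl s))) =
      0 := by
  rw [cobd_apply, bracket_T_single, diagMap_T_single, diagMap_T_single, bracket_single_sum_T,
    bracket_single_sum_T]
  simp [weight]

/-- The eigenvalue at `a` drops out because a diagonal map commutes with the torus; only the torus
part contributes. -/
theorem cobd_diagMap_T_single (l : Fin 3) {a : SLIndex n m} (ha : ∀ l, a ≠ .inr (.inl l)) :
    cobd (diagMap t x y) (e K n m (.inr (.inl l))) (e K n m a) =
      -((∑ r, t l r * weight K n m a r) • e K n m a) := by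
  obtain ⟨z, hz⟩ : ∃ z : K, diagMap t x y (e K n m a) = z • e K n m a := by
    rcases a with i | r | j
    · exact ⟨_, diagMap_X_single t x y i⟩
    · exact absurd rfl (ha r)
    · exact ⟨_, diagMap_Y_single t x y j⟩
  rw [cobd_apply, bracket_T_single, diagMap_T_single, bracket_single_sum_T, map_smul, hz, map_smul,
    bracket_T_single]
  module

theorem cobd_diagMap_X_X (h0 : 0 < n) (i : Fin n) (hi : 1 ≤ (i : ℕ)) :
    cobd (diagMap (n := n) (m := m) t x y) (e K n m (.inl ⟨0, h0⟩)) (e K n m (.inl i)) =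
      (x (i + 1) - x i - x 0) • X K n m (i + 2) := by
  rw [cobd_apply, diagMap_X_single, diagMap_X_single, map_smul, map_smul,
    bracket_comm K n m (e K n m (.inl i)), bracket_X_zero_X, if_pos hi, diagMap_X t x y (i + 1)]
  module

theorem cobd_diagMap_X_Y (h0 : 0 < n) (j : Fin m) :
    cobd (diagMap (n := n) (m := m) t x y) (e K n m (.inl ⟨0, h0⟩)) (e K n m (.inr (.inr j))) =
      (y (j + 1) - y j - x 0) • Y K n m (j + 2) := by
  rw [cobd_apply, diagMap_X_single, diagMap_Y_single, map_smul, map_smul,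
    bracket_comm K n m (e K n m (.inr (.inr j))), bracket_X_zero_Y, diagMap_Y t x y (j + 1)]
  module

theorem cobd_diagMap_eq_zero {a b : SLIndex n m} (ha : ∀ l, a ≠ .inr (.inl l))
    (hb : ∀ l, b ≠ .inr (.inl l)) (h : bracket K n m (e K n m a) (e K n m b) = 0) :
    cobd (diagMap t x y) (e K n m a) (e K n m b) = 0 := by
  have diag {a : SLIndex n m} (ha : ∀ l, a ≠ .inr (.inl l)) :
      ∃ z : K, diagMap t x y (e K n m a) = z • e K n m a := by
    rcases a with i | r | j
    · exact ⟨_, diagMap_X_single t x y i⟩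
    · exact absurd rfl (ha r)
    · exact ⟨_, diagMap_Y_single t x y j⟩
  obtain ⟨z, hz⟩ := diag ha
  obtain ⟨w, hw⟩ := diag hb
  rw [cobd_apply, hz, hw, map_smul, map_smul, bracket_comm K n m (e K n m b), h]
  simp

end Diag

theorem IsWeightZero.mem_B2 (p : ℕ) [CharP K p] (h2 : (2 : K) ≠ 0) (hn : n < p + 1) (hm : m < p)
    (hn1 : 1 < n) (hm0 : 0 < m) (hc : c ∈ (SL K n m).Z2) (hw : IsWeightZero c) :
    c ∈ (SL K n m).B2 := by
  have h0 : 0 < n := by omega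
  choose t ht using hw.exists_torus p hn hm hn1 hm0 hc
  -- The default `0` at the end of each chain is harmless: there the coefficient multiplies `X_{n+1}
  -- = 0` or `Y_{m+1} = 0`.
  let γ : ℕ → K := fun i => if h : i + 1 < n then
    c (e K n m (.inl ⟨0, h0⟩)) (e K n m (.inl ⟨i, by omega⟩)) (.inl ⟨i + 1, h⟩) else 0
  let δ : ℕ → K := fun j => if h : j + 1 < m then
    c (e K n m (.inl ⟨0, h0⟩)) (e K n m (.inr (.inr ⟨j, by omega⟩))) (.inr (.inr ⟨j + 1, h⟩)) else 0
  -- Partial sums solve `x (i + 1) - x i - x 0 = γ i` for `i ≥ 1` and `y (j + 1) - y j - x 0 = δ j`,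
  -- with the normalization `x 0 = 0`. The first sum starts at `1` because the chain of `X` vectors
  -- starts at `X₂`.
  let x : ℕ → K := fun i => ∑ s ∈ Finset.Ico 1 i, γ s
  let y : ℕ → K := fun j => ∑ s ∈ Finset.range j, δ s
  have hx0 : x 0 = 0 := by simp [x]
  refine mem_B2_of_eq_cobd hc.1 (diagMap t x y) (diagMap_odd t x y) ?_
  have nil (i : Fin n) (hi : 1 ≤ (i : ℕ)) : weight K n m (.inl i) 1 = 1 := by simp [weight, hi]
  have nil' (j : Fin m) : weight K n m (.inr (.inr j)) 2 = 1 := by simp [weight]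
  have TN (l) (a : SLIndex n m) (ha : ∀ l, a ≠ .inr (.inl l)) :
      c (e K n m (.inr (.inl l))) (e K n m a) =
        cobd (diagMap t x y) (e K n m (.inr (.inl l))) (e K n m a) := by
    rw [cobd_diagMap_T_single t x y l ha, ht l a ha, hw.apply_T_single p hn hm l ha]
    simp
  have XX (i : Fin n) (hi : 1 ≤ (i : ℕ)) : c (e K n m (.inl ⟨0, h0⟩)) (e K n m (.inl i)) =
      cobd (diagMap t x y) (e K n m (.inl ⟨0, h0⟩)) (e K n m (.inl i)) := by
    have hx : x (i + 1) - x i = γ i := by simp [x, Finset.sum_Ico_succ_top hi]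
    rw [cobd_diagMap_X_X t x y h0 i hi, hx0, hx, sub_zero]
    by_cases h : (i : ℕ) + 1 < n
    · rw [X_succ K n m ⟨i + 1, h⟩]
      simpa only [γ, dif_pos h] using hw.apply_X_X p hn hm h0 hi h
    · rw [X_eq_zero (by omega), smul_zero]
      exact hw.apply_X_X_last p hn h0 hi (by omega)
  have XY (j : Fin m) : c (e K n m (.inl ⟨0, h0⟩)) (e K n m (.inr (.inr j))) =
      cobd (diagMap t x y) (e K n m (.inl ⟨0, h0⟩)) (e K n m (.inr (.inr j))) := by
    have hy : y (j + 1) - y j = δ j := by simp [y, Finset.sum_range_succ]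
    rw [cobd_diagMap_X_Y t x y h0 j, hx0, hy, sub_zero]
    by_cases h : (j : ℕ) + 1 < m
    · rw [Y_succ K n m ⟨j + 1, h⟩]
      simpa only [δ, dif_pos h] using hw.apply_X_Y p hn hm h0 h
    · rw [Y_eq_zero (by omega), smul_zero]
      exact hw.apply_X_Y_last p hm h0 (by omega)
  have swap {a b : SLIndex n m} (hab : (∀ j, a ≠ .inr (.inr j)) ∨ ∀ j, b ≠ .inr (.inr j))
      (h : c (e K n m b) (e K n m a) = cobd (diagMap t x y) (e K n m b) (e K n m a)) :
      c (e K n m a) (e K n m b) = cobd (diagMap t x y) (e K n m a) (e K n m b) := by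
    rw [cochain_skew_single hc.1 hab, h, ← cobd_skew]
  have XY' (i : Fin n) (j : Fin m) : c (e K n m (.inl i)) (e K n m (.inr (.inr j))) =
      cobd (diagMap t x y) (e K n m (.inl i)) (e K n m (.inr (.inr j))) := by
    by_cases hi : 1 ≤ (i : ℕ)
    · rw [hw.apply_nilradical h2 (.inl (nil i hi)) (.inr (nil' j)),
        cobd_diagMap_eq_zero t x y (by simp) (by simp)]
      rw [bracket_single]
      simp [listed, show (i : ℕ) ≠ 0 by omega]
    · obtain rfl : i = ⟨0, h0⟩ := Fin.ext (by simp; omega)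
      exact XY j
  refine ext_basis fun a => ext_basis fun b => ?_
  rcases a with i | r | j <;> rcases b with i' | r' | j'
  · by_cases hi : 1 ≤ (i : ℕ) <;> by_cases hi' : 1 ≤ (i' : ℕ)
    · rw [hw.apply_nilradical h2 (.inl (nil i hi)) (.inl (nil i' hi')),
        cobd_diagMap_eq_zero t x y (by simp) (by simp)]
      rw [bracket_single]
      simp [listed, show (i : ℕ) ≠ 0 by omega, show (i' : ℕ) ≠ 0 by omega]
    · obtain rfl : i' = ⟨0, h0⟩ := Fin.ext (by simp; omega)
      exact swap (.inl (by simp)) (XX i hi)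
    · obtain rfl : i = ⟨0, h0⟩ := Fin.ext (by simp; omega)
      exact XX i' hi'
    · obtain rfl : i = i' := Fin.ext (by omega)
      rw [hc.1.1 _ (single_inl_mem_even i), cobd_diagMap_eq_zero t x y (by simp) (by simp)]
      rw [bracket_single, sub_self]
  · exact swap (.inl (by simp)) (TN _ _ (by simp))
  · exact XY' i j'
  · exact TN _ _ (by simp)
  · rw [hw.apply_T_T p hn hn1 hm hm0 hc, cobd_diagMap_T_T]
  · exact TN _ _ (by simp)
  · exact swap (.inr (by simp)) (XY' i' j)
  · exact swap (.inr (by simp)) (TN _ _ (by simp))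
  · rw [hw.apply_nilradical h2 (.inr (nil' j)) (.inr (nil' j')),
      cobd_diagMap_eq_zero t x y (by simp) (by simp)]
    exact bracket_odd_odd K n m _ (single_Y_mem_odd j) _ (single_Y_mem_odd j')

end SLSpace

/-- `SL^{n,m}` is rigid in every odd characteristic `p` with `1 < n ≤ p` and `1 ≤ m < p`. -/
theorem SL_isRigid (p : ℕ) [Fact p.Prime] (hp : p ≠ 2) (K : Type*) [Field K] [CharP K p]
    {n m : ℕ} (hn : 1 < n) (hn' : n < p + 1) (hm : 1 ≤ m) (hm' : m < p) :
    (SL K n m).IsRigid := by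
  refine LieSuperalgebra.isRigid_of_Z2_le_B2 fun c hc => ?_
  obtain ⟨c', hc', hB, hw⟩ := SLSpace.exists_weight_zero p hc
  -- Odd characteristic serves only to make the cochain vanish on pairs among `X₂, …, Xₙ, Y₁, …,
  -- Yₘ`.
  have h2 : (2 : K) ≠ 0 := Ring.two_ne_zero (by rwa [ringChar.eq K p])
  have := add_mem hB (hw.mem_B2 p h2 hn' hm' hn hm hc')
  rwa [sub_add_cancel] at this

theorem corollary6p1 (p : ℕ) (hp : p = 3 ∨ p = 5 ∨ p = 7 ∨ p = 11)
    (K : Type*) [Field K] [CharP K p] (n m : ℕ)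
    (hn : 1 < n) (hn' : n < p + 1) (hm : 1 ≤ m) (hm' : m < p) :
    (SL K n m).IsRigid := by
  have : Fact p.Prime := ⟨by rcases hp with rfl | rfl | rfl | rfl <;> norm_num⟩
  exact SL_isRigid p (by omega) K hn hn' hm hm'
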